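/- **Setting.** Let $d\ge 0$ and let $Z=(z_1,\dots,z_N)$ be points of $\mathbb R^d$ (the paper's case is $d=2$). Let $\psi(y)=e^{-|y|^2}$, $\varphi(x)=\psi(x-\cdot)\in L^2(\mathbb R^d)$ and $(\Phi^*p)(x)=\langle\varphi(x),p\rangle_{L^2}$ for $p\in L^2(\mathbb R^d)$. For a polynomial $P=\sum_\alpha a_\alpha X^\alpha$ write $P(\partial)=\sum_\alpha a_\alpha\partial^\alpha$, and set $\langle P,f\rangle_B=(P(\partial)[f])(0)$ for smooth $f$. For a linear functional $F$ on real polynomials in $d$ variables let $g_F=\sum_\alpha \frac{F(X^\alpha)}{\alpha!}x^\alpha$ (a formal power series). Let $\exp_Z$ be the linear span of the $g_F$, where $F$ runs over the functionals $P\mapsto P(z_i)$ and $P\mapsto(\partial_kP)(z_i)$, $1\le i\le N$, $1\le k\le d$. The least term $g_\downarrow$ of a nonzero power series $g$ is its nonzero homogeneous part of lowest degree, and $0_\downarrow=0$. The least interpolant space is $S_Z=\operatorname{span}\{g_\downarrow: g\in\exp_Z\}$. A *de Boor basis* of $S_Z$ is a basis of $S_Z$ that consists of least terms of elements of $\exp_Z$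 and is orthogonal with respect to $\langle P,Q\rangle_B$. Finally, $\eta_{W,Z}=\Phi^*p_{W,Z}$, where $p_{W,Z}$ is the unique element of minimal norm among the $p\in L^2(\mathbb R^d)$ with $(\Phi^*p)(0)=1$ and $(P(\partial)[\Phi^*p])(0)=0$ for all $P\in S_Z$ with $P(0)=0$. **Proposition.** In each of the cases below $p_{W,Z}$ exists and is unique, and $\eta_{W,Z}$ is as stated. 1. Suppose that $S_Z$ has a de Boor basis $\{P_\alpha\}_{\alpha\in J}$ that consists of all monomials $X^\alpha$ with $|\alpha|\le L$ together with homogeneous polynomials of degree $L+1$. Then, with $\tilde\psi(x)=e^{|x|^2/2}$, $$\eta_{W,Z}(x)=e^{-|x|^2/2}\sum_{\alpha\in J}\frac{\langle P_\alpha,\tilde\psi\rangle_B}{\langle P_\alpha,P_\alpha\rangle_B}\,P_\alpha(x).$$ 2. In particular, if $\{X^\alpha:\ |\alpha|\le L\}$ is a de Boor basis of $S_Z$, then $$\eta_{W,Z}(x)=e^{-|x|^2/2}\sum_{\alpha\in\mathbb N_0^d,\ 2|\alpha|\le L}\frac{x_1^{2\alpha_1}\cdots x_d^{2\alpha_d}}{2^{|\alpha|}\,\alpha!}.$$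 3. If $N\ge1$ and $z_1,\dots,z_N$ are distinct points all lying on a line parallel to the $k$-th coordinate axis (for instance, on the first axis, $k=1$), then $$\eta_{W,Z}(x)=e^{-|x|^2/2}\sum_{0\le 2j\le 2N-1}\frac{x_k^{2j}}{2^{j}\,j!}.$$ -/

import Mathlib

open MeasureTheory

noncomputable section

namespace SpikeCert

/-- The domain `ℝ^d`, with its Euclidean norm and Lebesgue measure. -/
abbrev Pt (d : ℕ) : Type := EuclideanSpace ℝ (Fin d)

/-- Real polynomials in `d` variables. -/
abbrev Poly (d : ℕ) : Type := MvPolynomial (Fin d) ℝ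

/-- The function on `ℝ^d` defined by a polynomial. -/
def Poly.toFun {d : ℕ} (P : Poly d) : Pt d → ℝ :=
  fun x => MvPolynomial.eval (fun i => x i) P

/-! ### Constant coefficient differential operators -/

/-- The partial derivative `∂_i f`. -/
def partialD {d : ℕ} (i : Fin d) (f : Pt d → ℝ) : Pt d → ℝ :=
  fun x => fderiv ℝ f x (EuclideanSpace.single i (1 : ℝ))

/-- The iterated partial derivative `∂^α f = ∂_1^{α_1} ⋯ ∂_d^{α_d} f`. -/
def multiD {d : ℕ} (α : Fin d →₀ ℕ) (f : Pt d → ℝ) : Pt d → ℝ :=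
  (List.finRange d).foldr (fun i g => (partialD i)^[α i] g) f

/-- The differential operator `P(∂)`: `P(∂)[f] = ∑_α a_α ∂^α f` for `P = ∑_α a_α X^α`. -/
def diffOp {d : ℕ} (P : Poly d) (f : Pt d → ℝ) : Pt d → ℝ :=
  fun x => ∑ α ∈ P.support, MvPolynomial.coeff α P * multiD α f x

/-- The pairing `⟨P, f⟩_B = (P(∂)[f])(0)`, for a polynomial `P` and a smooth function `f`. -/
def pairB {d : ℕ} (P : Poly d) (f : Pt d → ℝ) : ℝ := diffOp P f 0

/-! ### The least interpolant space -/

/-- The formal power series `g_F(x) = F(e^{⟨·, x⟩}) = ∑_α F(X^α) / α! x^α` of a linear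
functional `F` on polynomials. -/
def expSeries {d : ℕ} (F : Module.Dual ℝ (Poly d)) : MvPowerSeries (Fin d) ℝ :=
  fun α => F (MvPolynomial.monomial α 1) / ((∏ i, (α i).factorial : ℕ) : ℝ)

/-- `exp_𝓕`, the span of the series `g_F` for `F ∈ 𝓕`. -/
def expSpace {d : ℕ} (𝓕 : Set (Module.Dual ℝ (Poly d))) :
    Submodule ℝ (MvPowerSeries (Fin d) ℝ) :=
  Submodule.span ℝ (expSeries '' 𝓕)

/-- The least term of a power series: its homogeneous part of lowest degree among the nonzero
ones (and `0` for the zero series, all of whose coefficients vanish). -/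
def leastTerm {d : ℕ} (g : MvPowerSeries (Fin d) ℝ) : Poly d :=
  ∑ α ∈ Finset.univ.finsuppAntidiag g.order.toNat,
    MvPolynomial.monomial α (MvPowerSeries.coeff α g)

/-- The least interpolant space: the span of the least terms of the elements of `exp_𝓕`. -/
def leastSpace {d : ℕ} (𝓕 : Set (Module.Dual ℝ (Poly d))) : Submodule ℝ (Poly d) :=
  Submodule.span ℝ (leastTerm '' (expSpace 𝓕 : Set (MvPowerSeries (Fin d) ℝ)))

/-- The functional `P ↦ P(a)`. -/
def evalAt {d : ℕ} (a : Pt d) : Module.Dual ℝ (Poly d) :=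
  (MvPolynomial.aeval (R := ℝ) (fun i => a i)).toLinearMap

/-- The functional `P ↦ (∂_k P)(a)`. -/
def evalPartialAt {d : ℕ} (a : Pt d) (k : Fin d) : Module.Dual ℝ (Poly d) :=
  (evalAt a).comp (MvPolynomial.pderiv k).toLinearMap

/-- The functionals of first order Hermite interpolation at the positions `z`: the values and
the first partial derivatives at each `z i`. -/
def hermiteFunctionals {d N : ℕ} (z : Fin N → Pt d) : Set (Module.Dual ℝ (Poly d)) :=
  {F | ∃ i, F = evalAt (z i) ∨ ∃ k, F = evalPartialAt (z i) k}

/-- The space `S_Z`: the least interpolant space of first order Hermite interpolation at `z`. -/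
def hermiteLeast {d N : ℕ} (z : Fin N → Pt d) : Submodule ℝ (Poly d) :=
  leastSpace (hermiteFunctionals z)

/-- A de Boor basis of `S_Z`: a (finite) basis of `S_Z` made of least terms of elements of the
exponential space, and orthogonal with respect to `⟨P, Q⟩_B = (P(∂)[Q])(0)`. -/
structure IsDeBoorBasis {d N : ℕ} (z : Fin N → Pt d) (B : Finset (Poly d)) : Prop where
  isLeastTerm : ∀ P ∈ B, ∃ g ∈ expSpace (hermiteFunctionals z), leastTerm g = P
  linearIndep : LinearIndepOn ℝ id (B : Set (Poly d))
  span_eq : Submodule.span ℝ (B : Set (Poly d)) = hermiteLeast z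
  orthogonal : ∀ P ∈ B, ∀ Q ∈ B, P ≠ Q → pairB P Q.toFun = 0

/-! ### The limiting certificate -/

section Certificate

variable {H : Type*} [NormedAddCommGroup H] [InnerProductSpace ℝ H]

/-- The adjoint of `Φ m = ∫ φ(x) dm(x)`: `(Φ^* p)(x) = ⟨φ(x), p⟩`. -/
def adjointMap {d : ℕ} (φ : Pt d → H) (p : H) : Pt d → ℝ := fun x => inner ℝ (φ x) p

/-- The constraints on `p`: `(Φ^* p)(0) = 1`, and `(P(∂)[Φ^* p])(0) = 0` for every `P ∈ S_Z`
with `P(0) = 0`. -/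
def admissible {d N : ℕ} (φ : Pt d → H) (z : Fin N → Pt d) : Set H :=
  {p | adjointMap φ p 0 = 1 ∧
    ∀ P ∈ hermiteLeast z, P.toFun 0 = 0 → diffOp P (adjointMap φ p) 0 = 0}

/-- `p` is a solution of the minimal norm problem that defines `p_{W,Z}`. -/
def IsMinimalNorm {d N : ℕ} (φ : Pt d → H) (z : Fin N → Pt d) (p : H) : Prop :=
  p ∈ admissible φ z ∧ ∀ q ∈ admissible φ z, ‖p‖ ≤ ‖q‖

/-- `η = η_{W,Z}`: the minimal norm problem has exactly one solution `p_{W,Z}`, and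
`η = Φ^* p_{W,Z}`. -/
def IsEtaW {d N : ℕ} (φ : Pt d → H) (z : Fin N → Pt d) (η : Pt d → ℝ) : Prop :=
  ∃ p, IsMinimalNorm φ z p ∧ (∀ q, IsMinimalNorm φ z q → q = p) ∧ η = adjointMap φ p

end Certificate

/-! ### Gaussian convolution -/

theorem memLp_gaussian {d : ℕ} (x : Pt d) :
    MemLp (fun y : Pt d => Real.exp (-‖x - y‖ ^ 2)) 2 volume := by
  have hc : Continuous fun y : Pt d => Real.exp (-‖x - y‖ ^ 2) := by fun_prop
  rw [memLp_two_iff_integrable_sq hc.aestronglyMeasurable]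
  have h := (GaussianFourier.integrable_cexp_neg_mul_sq_norm_add (V := Pt d) (b := 2)
    (by norm_num) 0 0).norm
  have h2 := h.comp_sub_left x
  refine h2.congr (Filter.Eventually.of_forall fun y => ?_)
  simp only [Complex.norm_exp, ← Real.exp_nat_mul]
  congr 1
  norm_cast
  simp

/-- The Gaussian convolution kernel `φ(x) = ψ(x - ·) ∈ L²(ℝ^d)`, where
`ψ(y) = exp(-‖y‖²)`. -/
def gaussianKernel (d : ℕ) (x : Pt d) : Lp ℝ 2 (volume : Measure (Pt d)) :=
  (memLp_gaussian x).toLp (fun y : Pt d => Real.exp (-‖x - y‖ ^ 2))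

/-- `ψ̃(x) = exp(‖x‖² / 2)`. -/
def expHalfSq (d : ℕ) : Pt d → ℝ := fun x => Real.exp (‖x‖ ^ 2 / 2)

/-- The monomials `X^α` with `|α| ≤ L`. -/
def monomialsUpTo (d L : ℕ) : Set (Poly d) :=
  {P | ∃ α : Fin d →₀ ℕ, α.degree ≤ L ∧ P = MvPolynomial.monomial α 1}

end SpikeCert

end

open SpikeCert

/-!
The minimal norm problem is solved in the reproducing kernel Hilbert space of the Gaussian. Each
constraint functional `q ↦ (P(∂)[Φ^* q])(0)` is bounded on `L²` (`exists_inner_eq_pairB`), so an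
admissible `p` that is the representer of some `P₀ ∈ S_Z` has the same inner product with all
admissible elements, and is the unique one of minimal norm (`isEtaW_gaussFun`). Since the kernel
`⟨φ(x), φ(y)⟩` is a multiple of `exp (-‖x - y‖² / 2)`, the function `Φ^* p` of this representer is,
up to a constant, `H(P₀)(x) exp (-‖x‖² / 2)`, where `H` sends monomials to Hermite polynomials
(`adjointMap_eq_hermite`). It therefore suffices to find `Q ∈ H(S_Z)` such that
`Q(x) exp (-‖x‖² / 2)` satisfies the constraints.

Both requirements are read off from coefficients. The map `H` is unitriangular for divisibility of
monomials, hence onto on polynomials supported in a down-closed set of exponents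
(`exists_hermiteMap_eq`). As `exp (‖x‖² / 2) exp (-‖x‖² / 2) = 1`, if `Q` agrees with the Taylor
series of `exp (‖x‖² / 2)` at all exponents below those of `P`, then testing
`Q(x) exp (-‖x‖² / 2)` with `P` gives `P(0)` plus the pairing of `P` with `Q - exp (‖x‖² / 2)`
(`pairB_gaussFun_half`). This second term vanishes where the coefficients at the exponents of `P`
agree too, or, in the top degree, because `Q` is an orthogonal projection.

For points on a line parallel to the `k`-th axis, `S_Z` need not be computed exactly. A functional
that annihilates a polynomial with leading monomial `X^α` has no `X^α` in its least term; since
Hermite functionals annihilate `W² q` when `W` vanishes at the points, this bounds the exponents in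
`S_Z` (`hermiteLeast_le_of_line`). Conversely, the unisolvence of univariate Hermite interpolation
gives `X_k ^ n ∈ S_Z` for `n < 2N` (`monomial_single_mem_hermiteLeast`).
-/

noncomputable section

namespace SpikeCert

variable {d N : ℕ}

/-! ### Iterated operators -/

/-- The composition `T_1^{α_1} ⋯ T_d^{α_d}` of operators that need not commute, in the order in
which `multiD` composes partial derivatives. -/
def iterOp {M : Type*} (T : Fin d → M → M) (α : Fin d →₀ ℕ) (m : M) : M :=
  (List.finRange d).foldr (fun i g => (T i)^[α i] g) m

/-- Intertwining transfers iterated operators. Applied to partial derivatives acting on functions,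
on power series and on integrals, it reduces all of them to operators on polynomials. -/
theorem iterOp_semiconj {M M' : Type*} {T : Fin d → M → M} {T' : Fin d → M' → M'} {Φ : M → M'}
    (h : ∀ i m, T' i (Φ m) = Φ (T i m)) (α : Fin d →₀ ℕ) (m : M) :
    iterOp T' α (Φ m) = Φ (iterOp T α m) := by
  unfold iterOp
  induction List.finRange d with
  | nil => rfl
  | cons i l ih =>
    simp only [List.foldr_cons, ih]
    have hs : Function.Semiconj Φ (T i) (T' i) := fun m => (h i m).symm
    exact ((hs.iterate_right (α i)).eq _).symm

theorem sum_map_single_finRange (α : Fin d →₀ ℕ) :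
    ((List.finRange d).map fun i => Finsupp.single i (α i)).sum = α := by
  rw [← List.ofFn_eq_map, List.sum_ofFn]
  exact Finsupp.univ_sum_single α

/-! ### Taylor coefficients and the formal Gaussian -/

/-- The multi-index factorial `α! = ∏ i, (α i)!`, as a real number. -/
def multiFactorial (α : Fin d →₀ ℕ) : ℝ := ((∏ i, (α i).factorial : ℕ) : ℝ)

theorem multiFactorial_ne_zero (α : Fin d →₀ ℕ) : multiFactorial α ≠ 0 := by
  unfold multiFactorial
  exact_mod_cast Finset.prod_ne_zero_iff.2 fun i _ => (α i).factorial_ne_zero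

theorem multiFactorial_pos (α : Fin d →₀ ℕ) : 0 < multiFactorial α :=
  lt_of_le_of_ne (by unfold multiFactorial; positivity) (multiFactorial_ne_zero α).symm

theorem multiFactorial_zero : multiFactorial (0 : Fin d →₀ ℕ) = 1 := by
  simp [multiFactorial]

theorem multiFactorial_add_single (α : Fin d →₀ ℕ) (i : Fin d) :
    multiFactorial (α + Finsupp.single i 1) = (α i + 1) * multiFactorial α := by
  unfold multiFactorial
  rw [← Finset.mul_prod_erase _ _ (Finset.mem_univ i),
    ← Finset.mul_prod_erase _ (fun j => (α j).factorial) (Finset.mem_univ i)]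
  have : ∀ j ∈ Finset.univ.erase i,
      ((α + Finsupp.single i 1 : Fin d →₀ ℕ) j).factorial = (α j).factorial := by
    intro j hj
    simp [(Finset.ne_of_mem_erase hj).symm]
  rw [Finset.prod_congr rfl this]
  simp [Nat.factorial_succ, mul_assoc]

theorem coeff_iterate_pderiv (g : MvPowerSeries (Fin d) ℝ) (i : Fin d) (n : ℕ) (β : Fin d →₀ ℕ) :
    multiFactorial β * MvPowerSeries.coeff β ((MvPowerSeries.pderiv ℝ i)^[n] g) =
      multiFactorial (β + Finsupp.single i n) *
        MvPowerSeries.coeff (β + Finsupp.single i n) g := by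
  induction n generalizing β with
  | zero => simp
  | succ n ih =>
    rw [Function.iterate_succ_apply', MvPowerSeries.coeff_pderiv]
    have h := ih (β + Finsupp.single i 1)
    rw [multiFactorial_add_single, add_assoc, ← Finsupp.single_add, add_comm 1 n] at h
    rw [← h]
    ring

/-- The constant term of `∂^α g` is `α!` times the coefficient of `g` at `α`. -/
theorem coeff_zero_iterOp_pderiv (g : MvPowerSeries (Fin d) ℝ) (α : Fin d →₀ ℕ) :
    MvPowerSeries.coeff 0 (iterOp (fun i => MvPowerSeries.pderiv ℝ i) α g) =
      multiFactorial α * MvPowerSeries.coeff α g := by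
  have key : ∀ (l : List (Fin d)) (β : Fin d →₀ ℕ),
      multiFactorial β * MvPowerSeries.coeff β
          (l.foldr (fun i g => (MvPowerSeries.pderiv ℝ i)^[α i] g) g) =
        multiFactorial (β + (l.map fun i => Finsupp.single i (α i)).sum) *
          MvPowerSeries.coeff (β + (l.map fun i => Finsupp.single i (α i)).sum) g := by
    intro l
    induction l with
    | nil => simp
    | cons i l ih =>
      intro β
      rw [List.foldr_cons, coeff_iterate_pderiv, ih, List.map_cons, List.sum_cons, add_assoc]
  have := key (List.finRange d) 0
  rwa [sum_map_single_finRange, zero_add, multiFactorial_zero, one_mul] at this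

/-- The `n`-th Taylor coefficient at `0` of `t ↦ exp (-s t²)`. -/
def gaussCoeff (s : ℝ) (n : ℕ) : ℝ :=
  if Even n then (-s) ^ (n / 2) / ((n / 2).factorial : ℝ) else 0

theorem gaussCoeff_zero (s : ℝ) : gaussCoeff s 0 = 1 := by simp [gaussCoeff]

theorem gaussCoeff_one (s : ℝ) : gaussCoeff s 1 = 0 := by simp [gaussCoeff]

theorem gaussCoeff_two_mul (s : ℝ) (n : ℕ) :
    gaussCoeff s (2 * n) = (-s) ^ n / (n.factorial : ℝ) := by
  simp [gaussCoeff]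

theorem gaussCoeff_odd (s : ℝ) {n : ℕ} (h : ¬ Even n) : gaussCoeff s n = 0 := by
  simp [gaussCoeff, h]

theorem gaussCoeff_add_two (s : ℝ) (n : ℕ) :
    (n + 2) * gaussCoeff s (n + 2) = -(2 * s) * gaussCoeff s n := by
  rcases Nat.even_or_odd n with h | h
  · obtain ⟨m, rfl⟩ := h
    have h1 : m + m + 2 = 2 * (m + 1) := by ring
    rw [h1, ← two_mul, gaussCoeff_two_mul, gaussCoeff_two_mul, Nat.factorial_succ]
    push_cast
    have : (m.factorial : ℝ) ≠ 0 := by positivity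
    field_simp
    ring
  · have h1 : ¬ Even n := by simpa using h
    have h2 : ¬ Even (n + 2) := by simpa [parity_simps] using h
    rw [gaussCoeff_odd s h1, gaussCoeff_odd s h2]
    simp

/-- The power series of the Gaussian `x ↦ exp (-s ‖x‖²)`. -/
def gaussSeries (d : ℕ) (s : ℝ) : MvPowerSeries (Fin d) ℝ := fun α => ∏ i, gaussCoeff s (α i)

theorem coeff_gaussSeries (s : ℝ) (α : Fin d →₀ ℕ) :
    MvPowerSeries.coeff α (gaussSeries d s) = ∏ i, gaussCoeff s (α i) := rfl

theorem coeff_zero_gaussSeries (s : ℝ) :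
    MvPowerSeries.coeff (0 : Fin d →₀ ℕ) (gaussSeries d s) = 1 := by
  simp [coeff_gaussSeries, gaussCoeff_zero]

theorem pderiv_gaussSeries (s : ℝ) (i : Fin d) :
    MvPowerSeries.pderiv ℝ i (gaussSeries d s) =
      (-(2 * s)) • (MvPowerSeries.X i * gaussSeries d s) := by
  ext δ
  rw [MvPowerSeries.coeff_pderiv, MvPowerSeries.coeff_smul]
  have hsplit : ∀ n, ∏ j, gaussCoeff s ((δ + Finsupp.single i n) j) =
      gaussCoeff s (δ i + n) * ∏ j ∈ Finset.univ.erase i, gaussCoeff s (δ j) := by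
    intro n
    rw [← Finset.mul_prod_erase _ _ (Finset.mem_univ i)]
    congr 1
    · simp
    · refine Finset.prod_congr rfl fun j hj => ?_
      simp [(Finset.ne_of_mem_erase hj).symm]
  rw [coeff_gaussSeries, hsplit]
  by_cases h : δ i = 0
  · have h0 : MvPowerSeries.coeff δ (MvPowerSeries.X i * gaussSeries d s) = 0 := by
      rw [MvPowerSeries.X_def, MvPowerSeries.coeff_monomial_mul, if_neg]
      intro hle
      have := hle i
      simp [h] at this
    rw [h0, h]
    simp [gaussCoeff_one]
  · obtain ⟨γ, rfl⟩ : ∃ γ, δ = Finsupp.single i 1 + γ := by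
      refine ⟨δ - Finsupp.single i 1, (add_tsub_cancel_of_le ?_).symm⟩
      simpa [Finsupp.single_le_iff] using Nat.one_le_iff_ne_zero.2 h
    rw [MvPowerSeries.X_def, MvPowerSeries.coeff_add_monomial_mul, one_mul, coeff_gaussSeries,
      ← Finset.mul_prod_erase _ (fun j => gaussCoeff s (γ j)) (Finset.mem_univ i)]
    have hp : ∏ j ∈ Finset.univ.erase i, gaussCoeff s ((Finsupp.single i 1 + γ : Fin d →₀ ℕ) j) =
        ∏ j ∈ Finset.univ.erase i, gaussCoeff s (γ j) := by
      refine Finset.prod_congr rfl fun j hj => ?_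
      simp [(Finset.ne_of_mem_erase hj).symm]
    rw [hp]
    have h1 : (Finsupp.single i 1 + γ : Fin d →₀ ℕ) i + 1 = γ i + 2 := by simp; ring
    have h2 : (((Finsupp.single i 1 + γ : Fin d →₀ ℕ) i : ℕ) : ℝ) + 1 = γ i + 2 := by exact_mod_cast h1
    rw [h1, h2]
    linear_combination (∏ j ∈ Finset.univ.erase i, gaussCoeff s (γ j)) * gaussCoeff_add_two s (γ i)

/-- The product has vanishing partial derivatives and constant term `1`. -/
theorem gaussSeries_mul_neg (s : ℝ) : gaussSeries d s * gaussSeries d (-s) = 1 := by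
  refine MvPowerSeries.pderiv.ext (fun i => ?_) ?_
  · rw [Derivation.leibniz, pderiv_gaussSeries, pderiv_gaussSeries, MvPowerSeries.pderiv_one]
    simp only [smul_eq_mul, MvPowerSeries.smul_eq_C_mul, map_neg, map_mul]
    ring
  · rw [map_mul, ← MvPowerSeries.coeff_zero_eq_constantCoeff_apply,
      ← MvPowerSeries.coeff_zero_eq_constantCoeff_apply, coeff_zero_gaussSeries,
      coeff_zero_gaussSeries]
    simp

/-- Multiplication by a series with constant term `1` does not change a coefficient below which
all others vanish. -/
theorem coeff_mul_of_forall_lt {D E : MvPowerSeries (Fin d) ℝ} {α : Fin d →₀ ℕ}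
    (hE : MvPowerSeries.coeff 0 E = 1) (hD : ∀ β < α, MvPowerSeries.coeff β D = 0) :
    MvPowerSeries.coeff α (D * E) = MvPowerSeries.coeff α D := by
  classical
  rw [MvPowerSeries.coeff_mul, Finset.sum_eq_single (α, 0)]
  · simp [hE]
  · rintro ⟨β, γ⟩ hm hne
    rw [Finset.HasAntidiagonal.mem_antidiagonal] at hm
    dsimp only at hm ⊢
    rw [hD β, zero_mul]
    refine lt_of_le_of_ne (hm ▸ le_self_add) ?_
    rintro rfl
    exact hne (by simpa using hm)
  · intro h
    simp at h

/-- The operator `R ↦ ∂_i R - 2s X_i R`: the effect of `∂_i` on the factor `R` of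
`R(x) exp (-s ‖x‖²)`. -/
def gaussOp (s : ℝ) (i : Fin d) (R : Poly d) : Poly d :=
  MvPolynomial.pderiv i R + MvPolynomial.C (-(2 * s)) * (MvPolynomial.X i * R)

theorem pderiv_coe_mul_gaussSeries (s : ℝ) (i : Fin d) (R : Poly d) :
    MvPowerSeries.pderiv ℝ i ((R : MvPowerSeries (Fin d) ℝ) * gaussSeries d s) =
      (gaussOp s i R : Poly d) * gaussSeries d s := by
  rw [Derivation.leibniz, pderiv_gaussSeries, MvPowerSeries.pderiv_coe, gaussOp, 
    MvPolynomial.coe_add, MvPolynomial.coe_mul, MvPolynomial.coe_mul,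
    MvPolynomial.coe_C, MvPolynomial.coe_X]
  simp only [smul_eq_mul, MvPowerSeries.smul_eq_C_mul]
  ring

theorem constantCoeff_iterOp_gaussOp (s : ℝ) (α : Fin d →₀ ℕ) (R : Poly d) :
    MvPolynomial.constantCoeff (iterOp (gaussOp s) α R) =
      multiFactorial α *
        MvPowerSeries.coeff α ((R : MvPowerSeries (Fin d) ℝ) * gaussSeries d s) := by
  rw [← coeff_zero_iterOp_pderiv]
  rw [iterOp_semiconj (T := gaussOp s)
    (Φ := fun R : Poly d => (R : MvPowerSeries (Fin d) ℝ) * gaussSeries d s)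
    (fun i R => pderiv_coe_mul_gaussSeries s i R)]
  rw [MvPowerSeries.coeff_zero_eq_constantCoeff_apply, map_mul,
    ← MvPowerSeries.coeff_zero_eq_constantCoeff_apply (gaussSeries d s), coeff_zero_gaussSeries,
    mul_one, ← MvPowerSeries.coeff_zero_eq_constantCoeff_apply, MvPolynomial.coeff_coe]
  rfl

/-! ### Hermite polynomials -/

theorem mem_restrictSupport_iff_coeff {D : Set (Fin d →₀ ℕ)} {P : Poly d} :
    P ∈ MvPolynomial.restrictSupport ℝ D ↔ ∀ β, MvPolynomial.coeff β P ≠ 0 → β ∈ D := by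
  rw [MvPolynomial.mem_restrictSupport_iff]
  exact ⟨fun h β hβ => h (MvPolynomial.mem_support_iff.2 hβ),
    fun h β hβ => h β (MvPolynomial.mem_support_iff.1 hβ)⟩

/-- The operator `R ↦ X_i R - ∂_i R`, which raises the degree of a Hermite polynomial by one in
the `i`-th variable. -/
def hermiteStep (i : Fin d) (R : Poly d) : Poly d :=
  MvPolynomial.X i * R - MvPolynomial.pderiv i R

/-- The linear map that sends the monomial `X^α` to the (probabilists') Hermite polynomial of
index `α`. -/
def hermiteMap (d : ℕ) : Poly d →ₗ[ℝ] Poly d :=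
  (MvPolynomial.basisMonomials (Fin d) ℝ).constr ℝ fun α => iterOp hermiteStep α 1

theorem hermiteMap_monomial (α : Fin d →₀ ℕ) :
    hermiteMap d (MvPolynomial.monomial α 1) = iterOp hermiteStep α 1 := by
  have := (MvPolynomial.basisMonomials (Fin d) ℝ).constr_basis ℝ
    (fun α => iterOp hermiteStep α (1 : Poly d)) α
  rwa [MvPolynomial.coe_basisMonomials] at this

/-- The substitution `R(x) ↦ R(-x)`. -/
def reflect (d : ℕ) : Poly d →ₐ[ℝ] Poly d := MvPolynomial.aeval fun i => -MvPolynomial.X i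

theorem reflect_pderiv (i : Fin d) (R : Poly d) :
    reflect d (MvPolynomial.pderiv i R) = -MvPolynomial.pderiv i (reflect d R) := by
  induction R using MvPolynomial.induction_on with
  | C a => simp [reflect]
  | add p q hp hq => simp only [map_add, hp, hq, neg_add]
  | mul_X p n hp =>
    have hX : reflect d (MvPolynomial.X n) = -MvPolynomial.X n := by simp [reflect]
    rw [MvPolynomial.pderiv_mul, map_add, map_mul, map_mul, map_mul, hp, hX,
      MvPolynomial.pderiv_mul, map_neg, MvPolynomial.pderiv_X]
    by_cases h : n = i
    · subst h; simp only [Pi.single_eq_same, map_one]; ring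
    · simp only [Pi.single_eq_of_ne h, map_zero]; ring

theorem reflect_gaussOp (i : Fin d) (R : Poly d) :
    hermiteStep i (reflect d R) = reflect d (gaussOp (1 / 2) i R) := by
  have hX : reflect d (MvPolynomial.X i) = -MvPolynomial.X i := by simp [reflect]
  rw [gaussOp, hermiteStep, map_add, reflect_pderiv, map_mul, map_mul, hX,
    show (-(2 * (1 / 2)) : ℝ) = -1 by norm_num]
  simp only [map_neg, map_one]
  ring

theorem toFun_reflect (R : Poly d) (x : Pt d) : (reflect d R).toFun x = R.toFun (-x) := by
  unfold Poly.toFun reflect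
  induction R using MvPolynomial.induction_on with
  | C a => simp
  | add p q hp hq => simp only [map_add, hp, hq]
  | mul_X p n hp => simp only [map_mul, hp]; simp

theorem toFun_iterOp_gaussOp_neg (α : Fin d →₀ ℕ) (x : Pt d) :
    (iterOp (gaussOp (1 / 2)) α (1 : Poly d)).toFun (-x) =
      (hermiteMap d (MvPolynomial.monomial α 1)).toFun x := by
  rw [hermiteMap_monomial, ← toFun_reflect,
    ← iterOp_semiconj (T := gaussOp (1 / 2)) (Φ := reflect d) reflect_gaussOp, map_one]

theorem hermiteStep_sub_monomial {γ : Fin d →₀ ℕ} {R : Poly d}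
    (h : R - MvPolynomial.monomial γ 1 ∈ MvPolynomial.restrictSupport ℝ (Set.Iio γ)) (i : Fin d) :
    hermiteStep i R - MvPolynomial.monomial (γ + Finsupp.single i 1) 1 ∈
      MvPolynomial.restrictSupport ℝ (Set.Iio (γ + Finsupp.single i 1)) := by
  have hlt : γ < γ + Finsupp.single i 1 := by
    refine lt_of_le_of_ne le_self_add fun h => ?_
    simpa using DFunLike.congr_fun h i
  have hR : R ∈ MvPolynomial.restrictSupport ℝ (Set.Iic γ) := by
    have h1 : R = (R - MvPolynomial.monomial γ 1) + MvPolynomial.monomial γ 1 := by ring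
    rw [h1]
    refine Submodule.add_mem _ (MvPolynomial.restrictSupport_mono ℝ Set.Iio_subset_Iic_self h) ?_
    simp [MvPolynomial.monomial_mem_restrictSupport]
  have hmon : MvPolynomial.monomial (γ + Finsupp.single i 1) (1 : ℝ) =
      MvPolynomial.X i * MvPolynomial.monomial γ 1 := by
    rw [MvPolynomial.X, MvPolynomial.monomial_mul, add_comm, one_mul]
  have hstep : hermiteStep i R - MvPolynomial.monomial (γ + Finsupp.single i 1) 1 =
      MvPolynomial.X i * (R - MvPolynomial.monomial γ 1) - MvPolynomial.pderiv i R := by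
    rw [hmon, hermiteStep]; ring
  rw [hstep]
  refine Submodule.sub_mem _ ?_ ?_
  · rw [mem_restrictSupport_iff_coeff] at h ⊢
    intro β hβ
    rw [MvPolynomial.coeff_X_mul'] at hβ
    split_ifs at hβ with hi
    · have h1 : β - Finsupp.single i 1 < γ := h _ hβ
      have h2 : β = (β - Finsupp.single i 1) + Finsupp.single i 1 := by
        refine (tsub_add_cancel_of_le ?_).symm
        simpa [Finsupp.single_le_iff, Nat.one_le_iff_ne_zero] using hi
      rw [h2]
      exact add_lt_add_left h1 _
    · exact absurd rfl hβ
  · rw [mem_restrictSupport_iff_coeff] at hR ⊢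
    intro β hβ
    rw [MvPolynomial.coeff_pderiv] at hβ
    have h1 : β + Finsupp.single i 1 ≤ γ := hR _ (left_ne_zero_of_mul hβ)
    exact (le_self_add.trans h1).trans_lt hlt

/-- The Hermite polynomial of index `α` is `X^α` plus proper divisors of `X^α`. -/
theorem hermiteMap_monomial_sub (α : Fin d →₀ ℕ) :
    hermiteMap d (MvPolynomial.monomial α 1) - MvPolynomial.monomial α 1 ∈
      MvPolynomial.restrictSupport ℝ (Set.Iio α) := by
  have iter : ∀ (i : Fin d) (n : ℕ) (γ : Fin d →₀ ℕ) (R : Poly d),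
      R - MvPolynomial.monomial γ 1 ∈ MvPolynomial.restrictSupport ℝ (Set.Iio γ) →
      (hermiteStep i)^[n] R - MvPolynomial.monomial (γ + Finsupp.single i n) 1 ∈
        MvPolynomial.restrictSupport ℝ (Set.Iio (γ + Finsupp.single i n)) := by
    intro i n
    induction n with
    | zero => intro γ R h; simpa using h
    | succ n ih =>
      intro γ R h
      rw [Function.iterate_succ_apply', Finsupp.single_add, ← add_assoc]
      exact hermiteStep_sub_monomial (ih γ R h) i
  have key : ∀ l : List (Fin d),
      l.foldr (fun i g => (hermiteStep i)^[α i] g) (1 : Poly d) -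
          MvPolynomial.monomial (l.map fun i => Finsupp.single i (α i)).sum 1 ∈
        MvPolynomial.restrictSupport ℝ (Set.Iio (l.map fun i => Finsupp.single i (α i)).sum) := by
    intro l
    induction l with
    | nil => simp
    | cons i l ih =>
      rw [List.foldr_cons, List.map_cons, List.sum_cons, add_comm]
      exact iter i _ _ _ ih
  have := key (List.finRange d)
  rw [sum_map_single_finRange] at this
  rw [hermiteMap_monomial]
  exact this

/-- The Hermite map subtracts from `P` only monomials that strictly divide a monomial of `P`. -/
theorem hermiteMap_sub_mem {D D' : Set (Fin d →₀ ℕ)} (h : ∀ α ∈ D, ∀ β < α, β ∈ D')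
    {P : Poly d} (hP : P ∈ MvPolynomial.restrictSupport ℝ D) :
    hermiteMap d P - P ∈ MvPolynomial.restrictSupport ℝ D' := by
  rw [MvPolynomial.restrictSupport_eq_span] at hP
  induction hP using Submodule.span_induction with
  | mem P hP =>
    obtain ⟨α, hα, rfl⟩ := hP
    exact MvPolynomial.restrictSupport_mono ℝ (fun β hβ => h α hα β hβ) (hermiteMap_monomial_sub α)
  | zero => simp
  | add P Q _ _ hP hQ =>
    rw [map_add, add_sub_add_comm]
    exact Submodule.add_mem _ hP hQ
  | smul c P _ hP =>
    rw [map_smul, ← smul_sub]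
    exact Submodule.smul_mem _ _ hP

/-- The Hermite map is unitriangular, hence onto, on the polynomials with monomials in a
down-closed set. -/
theorem exists_hermiteMap_eq {D : Set (Fin d →₀ ℕ)} (hD : IsLowerSet D) {Q : Poly d}
    (hQ : Q ∈ MvPolynomial.restrictSupport ℝ D) :
    ∃ P ∈ MvPolynomial.restrictSupport ℝ D, hermiteMap d P = Q := by
  have mon : ∀ α ∈ D, MvPolynomial.monomial α (1 : ℝ) ∈
      (MvPolynomial.restrictSupport ℝ D).map (hermiteMap d) := by
    intro α
    induction α using WellFoundedLT.induction with
    | ind α ih =>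
      intro hα
      have h1 : MvPolynomial.monomial α (1 : ℝ) = hermiteMap d (MvPolynomial.monomial α 1) -
          (hermiteMap d (MvPolynomial.monomial α 1) - MvPolynomial.monomial α 1) := by ring
      rw [h1]
      refine Submodule.sub_mem _ (Submodule.mem_map_of_mem ?_) ?_
      · exact (MvPolynomial.monomial_mem_restrictSupport ℝ).2 (Or.inl hα)
      · have h2 := hermiteMap_monomial_sub α
        rw [MvPolynomial.restrictSupport_eq_span] at h2
        refine Submodule.span_le.2 ?_ h2
        rintro _ ⟨β, hβ, rfl⟩
        exact ih β hβ (hD (le_of_lt hβ) hα)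
  rw [MvPolynomial.restrictSupport_eq_span] at hQ
  have : Q ∈ (MvPolynomial.restrictSupport ℝ D).map (hermiteMap d) := by
    refine Submodule.span_le.2 ?_ hQ
    rintro _ ⟨β, hβ, rfl⟩
    exact mon β hβ
  exact this

/-! ### Derivatives of a polynomial times a Gaussian -/

/-- The function `x ↦ R(x) exp (-s ‖x‖²)`. -/
def gaussFun (s : ℝ) (R : Poly d) : Pt d → ℝ := fun x => R.toFun x * Real.exp (-s * ‖x‖ ^ 2)

theorem hasFDerivAt_toFun (R : Poly d) (x : Pt d) :
    HasFDerivAt R.toFun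
      (∑ i, Poly.toFun (MvPolynomial.pderiv i R) x • (EuclideanSpace.proj i : Pt d →L[ℝ] ℝ)) x := by
  induction R using MvPolynomial.induction_on with
  | C a =>
    have h : Poly.toFun (MvPolynomial.C a : Poly d) = fun _ => a := by funext; simp [Poly.toFun]
    simpa [h, Poly.toFun] using hasFDerivAt_const a x
  | add p q hp hq =>
    have h : Poly.toFun (p + q) = Poly.toFun p + Poly.toFun q := by funext; simp [Poly.toFun]
    rw [h]
    refine (hp.add hq).congr_fderiv ?_
    simp [Poly.toFun, add_smul, Finset.sum_add_distrib]
  | mul_X p n hp =>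
    have h : Poly.toFun (p * MvPolynomial.X n) =
        fun y => Poly.toFun p y * (EuclideanSpace.proj n : Pt d →L[ℝ] ℝ) y := by
      funext; simp [Poly.toFun]
    rw [h]
    refine (hp.mul (EuclideanSpace.proj n : Pt d →L[ℝ] ℝ).hasFDerivAt).congr_fderiv ?_
    ext v
    have hs : ∀ i, Poly.toFun (MvPolynomial.pderiv i (p * MvPolynomial.X n)) x =
        Poly.toFun (MvPolynomial.pderiv i p) x * x n + if i = n then Poly.toFun p x else 0 := by
      intro i
      rw [MvPolynomial.pderiv_mul, MvPolynomial.pderiv_X]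
      by_cases hi : i = n
      · subst hi; simp [Poly.toFun]
      · simp [Poly.toFun, hi]
    simp only [hs, sum_apply, add_apply,
      smul_apply, PiLp.proj_apply, smul_eq_mul, add_mul,
      Finset.sum_add_distrib, ite_mul, zero_mul, Finset.sum_ite_eq', Finset.mem_univ, if_true]
    rw [Finset.mul_sum, add_comm]
    congr 1
    exact Finset.sum_congr rfl fun i _ => by ring

theorem hasFDerivAt_gaussFun (s : ℝ) (R : Poly d) (x : Pt d) :
    HasFDerivAt (gaussFun s R)
      (∑ i, gaussFun s (gaussOp s i R) x • (EuclideanSpace.proj i : Pt d →L[ℝ] ℝ)) x := by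
  have h1 := ((hasStrictFDerivAt_norm_sq x).hasFDerivAt.const_mul (-s)).exp
  refine ((hasFDerivAt_toFun R x).mul h1).congr_fderiv ?_
  ext v
  have hin : inner ℝ x v = ∑ i, x i * v i := by
    rw [PiLp.inner_apply]
    exact Finset.sum_congr rfl fun i _ => by simp [mul_comm]
  have hg : ∀ i, gaussFun s (gaussOp s i R) x = (Poly.toFun (MvPolynomial.pderiv i R) x -
      2 * s * x i * R.toFun x) * Real.exp (-s * ‖x‖ ^ 2) := by
    intro i
    simp only [gaussFun, gaussOp, Poly.toFun, map_add, map_mul, MvPolynomial.eval_C,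
      MvPolynomial.eval_X]
    ring
  simp only [hg, sum_apply, add_apply,
      smul_apply, PiLp.proj_apply, smul_eq_mul, innerSL_apply_apply,
      nsmul_eq_mul, hin]
  simp only [Finset.mul_sum, ← Finset.sum_add_distrib]
  refine Finset.sum_congr rfl fun i _ => ?_
  push_cast
  ring

theorem hasFDerivAt_gaussFun_sub (s : ℝ) (R : Poly d) (x a : Pt d) :
    HasFDerivAt (fun x => gaussFun s R (x - a))
      (∑ i, gaussFun s (gaussOp s i R) (x - a) • (EuclideanSpace.proj i : Pt d →L[ℝ] ℝ)) x :=
  (HasFDerivAt.comp (g := gaussFun s R) x (hasFDerivAt_gaussFun s R (x - a)) (hasFDerivAt_sub_const a)).congr_fderiv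
    (ContinuousLinearMap.comp_id _)

theorem sum_smul_proj_apply_single (c : Fin d → ℝ) (i : Fin d) :
    (∑ j, c j • (EuclideanSpace.proj j : Pt d →L[ℝ] ℝ)) (EuclideanSpace.single i (1 : ℝ)) =
      c i := by
  simp

theorem partialD_gaussFun (c s : ℝ) (a : Pt d) (i : Fin d) (R : Poly d) :
    partialD i (fun x => c * gaussFun s R (x - a)) =
      fun x => c * gaussFun s (gaussOp s i R) (x - a) := by
  funext x
  rw [partialD, ((hasFDerivAt_gaussFun_sub s R x a).const_mul c).fderiv,
    smul_apply, sum_smul_proj_apply_single, smul_eq_mul]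

theorem multiD_gaussFun (c s : ℝ) (a : Pt d) (α : Fin d →₀ ℕ) (R : Poly d) :
    multiD α (fun x => c * gaussFun s R (x - a)) =
      fun x => c * gaussFun s (iterOp (gaussOp s) α R) (x - a) :=
  iterOp_semiconj (Φ := fun R => fun x => c * gaussFun s R (x - a)) (partialD_gaussFun c s a) α R

theorem continuous_gaussFun (s : ℝ) (R : Poly d) : Continuous (gaussFun s R) :=
  continuous_iff_continuousAt.2 fun x => (hasFDerivAt_gaussFun s R x).continuousAt

/-! ### The pairing as a linear form -/

/-- The pairing `P ↦ ⟨P, f⟩_B` as a linear form. -/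
def pairLin (f : Pt d → ℝ) : Poly d →ₗ[ℝ] ℝ :=
  (MvPolynomial.basisMonomials (Fin d) ℝ).constr ℝ fun α => multiD α f 0

theorem pairLin_monomial (f : Pt d → ℝ) (α : Fin d →₀ ℕ) (c : ℝ) :
    pairLin f (MvPolynomial.monomial α c) = c * multiD α f 0 := by
  have := (MvPolynomial.basisMonomials (Fin d) ℝ).constr_basis ℝ (fun α => multiD α f 0) α
  rw [MvPolynomial.coe_basisMonomials] at this
  have h1 : MvPolynomial.monomial α c = c • MvPolynomial.monomial α (1 : ℝ) := by
    rw [MvPolynomial.smul_monomial, smul_eq_mul, mul_one]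
  rw [h1, map_smul, smul_eq_mul]
  exact congrArg (c * ·) this

theorem pairLin_apply (f : Pt d → ℝ) (P : Poly d) : pairLin f P = pairB P f := by
  conv_lhs => rw [P.as_sum]
  simp only [map_sum, pairLin_monomial]
  rfl

/-- For `f(x) = R(x) exp (-s ‖x‖²)` the pairing is read off from the Taylor series of `f`. -/
theorem pairB_gaussFun (s : ℝ) (P R : Poly d) :
    pairB P (gaussFun s R) = ∑ α ∈ P.support, MvPolynomial.coeff α P *
      (multiFactorial α *
        MvPowerSeries.coeff α ((R : MvPowerSeries (Fin d) ℝ) * gaussSeries d s)) := by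
  unfold pairB diffOp
  refine Finset.sum_congr rfl fun α _ => ?_
  have h := multiD_gaussFun 1 s 0 α R
  simp only [one_mul, sub_zero] at h
  rw [h, ← constantCoeff_iterOp_gaussOp, ← MvPolynomial.eval_zero]
  simp only [gaussFun, Poly.toFun, norm_zero]
  simp

/-! ### Gaussian bounds -/

theorem exists_abs_toFun_le (R : Poly d) {b : ℝ} (hb : 0 < b) :
    ∃ C : ℝ, 0 ≤ C ∧ ∀ u : Pt d, |R.toFun u| ≤ C * Real.exp (b * ‖u‖ ^ 2) := by
  induction R using MvPolynomial.induction_on generalizing b with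
  | C a =>
    refine ⟨|a|, abs_nonneg a, fun u => ?_⟩
    have h : 1 ≤ Real.exp (b * ‖u‖ ^ 2) := Real.one_le_exp (by positivity)
    simpa [Poly.toFun] using mul_le_mul_of_nonneg_left h (abs_nonneg a)
  | add p q hp hq =>
    obtain ⟨C, hC, hp⟩ := hp hb
    obtain ⟨C', hC', hq⟩ := hq hb
    refine ⟨C + C', by positivity, fun u => ?_⟩
    have h : Poly.toFun (p + q) u = Poly.toFun p u + Poly.toFun q u := by simp [Poly.toFun]
    rw [h, add_mul]
    exact (abs_add_le _ _).trans (add_le_add (hp u) (hq u))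
  | mul_X p n hp =>
    obtain ⟨C, hC, hp⟩ := hp (half_pos hb)
    refine ⟨C * (1 + 2 / b), by positivity, fun u => ?_⟩
    have h : Poly.toFun (p * MvPolynomial.X n) u = Poly.toFun p u * u n := by simp [Poly.toFun]
    have hn : |u n| ≤ ‖u‖ := by simpa using PiLp.norm_apply_le u n
    have h1 : b / 2 * ‖u‖ ^ 2 + 1 ≤ Real.exp (b / 2 * ‖u‖ ^ 2) := Real.add_one_le_exp _
    have h2 : |u n| ≤ (1 + 2 / b) * Real.exp (b / 2 * ‖u‖ ^ 2) := by
      refine hn.trans (le_trans ?_ (mul_le_mul_of_nonneg_left h1 (by positivity)))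
      have : (1 + 2 / b) * (b / 2 * ‖u‖ ^ 2 + 1) =
          ‖u‖ ^ 2 + 1 + (b / 2 * ‖u‖ ^ 2 + 2 / b) := by
        field_simp
        ring
      rw [this]
      have h3 : 0 ≤ b / 2 * ‖u‖ ^ 2 + 2 / b := by positivity
      nlinarith [sq_nonneg (‖u‖ - 1), norm_nonneg u]
    rw [h, abs_mul]
    calc |Poly.toFun p u| * |u n| ≤ (C * Real.exp (b / 2 * ‖u‖ ^ 2)) *
          ((1 + 2 / b) * Real.exp (b / 2 * ‖u‖ ^ 2)) :=
        mul_le_mul (hp u) h2 (abs_nonneg _) (by positivity)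
      _ = C * (1 + 2 / b) * (Real.exp (b / 2 * ‖u‖ ^ 2) * Real.exp (b / 2 * ‖u‖ ^ 2)) := by ring
      _ = _ := by rw [← Real.exp_add]; ring_nf

/-- A Gaussian bound that is uniform for `u` in the unit ball around `v`, as dominated
differentiation requires. -/
theorem exists_abs_gaussFun_le (R : Poly d) :
    ∃ C : ℝ, 0 ≤ C ∧ ∀ u v : Pt d, ‖u - v‖ ≤ 1 →
      |gaussFun 1 R u| ≤ C * Real.exp (-(1 / 4) * ‖v‖ ^ 2) := by
  obtain ⟨C, hC, h⟩ := exists_abs_toFun_le R (b := 1 / 2) (by norm_num)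
  refine ⟨C * Real.exp (1 / 2), by positivity, fun u v huv => ?_⟩
  have hv : ‖v‖ ≤ ‖u‖ + 1 := by
    have := norm_sub_norm_le v u
    rw [norm_sub_rev] at this
    linarith
  have hv2 : ‖v‖ ^ 2 ≤ 2 * ‖u‖ ^ 2 + 2 := by
    nlinarith [norm_nonneg v, norm_nonneg u, sq_nonneg (‖u‖ - 1)]
  rw [gaussFun, abs_mul, Real.abs_exp]
  calc |R.toFun u| * Real.exp (-1 * ‖u‖ ^ 2)
      ≤ C * Real.exp (1 / 2 * ‖u‖ ^ 2) * Real.exp (-1 * ‖u‖ ^ 2) :=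
        mul_le_mul_of_nonneg_right (h u) (Real.exp_pos _).le
    _ = C * Real.exp (-(1 / 2) * ‖u‖ ^ 2) := by
        rw [mul_assoc, ← Real.exp_add]; ring_nf
    _ ≤ C * Real.exp (1 / 2 + -(1 / 4) * ‖v‖ ^ 2) :=
        mul_le_mul_of_nonneg_left (Real.exp_le_exp.2 (by linarith)) hC
    _ = _ := by rw [Real.exp_add, mul_assoc]

theorem integrable_exp_neg_mul_sq_norm_sub {b : ℝ} (hb : 0 < b) (x : Pt d) :
    Integrable (fun y : Pt d => Real.exp (-b * ‖x - y‖ ^ 2)) := by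
  have h := (GaussianFourier.integrable_cexp_neg_mul_sq_norm_add (V := Pt d) (b := b)
    (by simpa using hb) 0 0).norm
  refine (h.comp_sub_left x).congr (Filter.Eventually.of_forall fun y => ?_)
  simp only [Complex.norm_exp]
  congr 1
  norm_cast
  simp

theorem memLp_exp_neg_mul_sq_norm_sub {b : ℝ} (hb : 0 < b) (x : Pt d) :
    MemLp (fun y : Pt d => Real.exp (-b * ‖x - y‖ ^ 2)) 2 volume := by
  have hc : Continuous fun y : Pt d => Real.exp (-b * ‖x - y‖ ^ 2) := by fun_prop
  rw [memLp_two_iff_integrable_sq hc.aestronglyMeasurable]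
  refine (integrable_exp_neg_mul_sq_norm_sub (b := 2 * b) (by positivity) x).congr
    (Filter.Eventually.of_forall fun y => ?_)
  simp only [← Real.exp_nat_mul]
  congr 1
  push_cast
  ring

theorem memLp_gaussFun_sub (R : Poly d) (x : Pt d) :
    MemLp (fun y => gaussFun 1 R (x - y)) 2 volume := by
  obtain ⟨C, hC, h⟩ := exists_abs_gaussFun_le R
  refine ((memLp_exp_neg_mul_sq_norm_sub (b := 1 / 4) (by norm_num) x).const_mul C).mono'
    ((continuous_gaussFun 1 R).comp (continuous_const.sub continuous_id)).aestronglyMeasurable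
    (Filter.Eventually.of_forall fun y => h _ _ (by simp))

/-! ### Differentiation of Gaussian convolutions -/

/-- The convolution of `R(x) exp (-‖x‖²)` with a square integrable function. -/
def gaussConv (q : Lp ℝ 2 (volume : Measure (Pt d))) (R : Poly d) : Pt d → ℝ :=
  fun x => ∫ y, gaussFun 1 R (x - y) * q y

theorem integrable_gaussFun_mul (q : Lp ℝ 2 (volume : Measure (Pt d))) (R : Poly d) (x : Pt d) :
    Integrable fun y => gaussFun 1 R (x - y) * q y :=
  (memLp_gaussFun_sub R x).integrable_mul (Lp.memLp q)

theorem integrable_sum_gaussFun_smul (q : Lp ℝ 2 (volume : Measure (Pt d))) (R : Poly d)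
    (x : Pt d) :
    Integrable fun y => ∑ j, (gaussFun 1 (gaussOp 1 j R) (x - y) * q y) •
      (EuclideanSpace.proj j : Pt d →L[ℝ] ℝ) := by
  have h : ∀ j, Integrable fun y => (gaussFun 1 (gaussOp 1 j R) (x - y) * q y) •
      (EuclideanSpace.proj j : Pt d →L[ℝ] ℝ) := fun j =>
    Integrable.smul_const (integrable_gaussFun_mul q (gaussOp 1 j R) x)
      (EuclideanSpace.proj j : Pt d →L[ℝ] ℝ)
  exact integrable_finsetSum (f := fun j y => (gaussFun 1 (gaussOp 1 j R) (x - y) * q y) •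
      (EuclideanSpace.proj j : Pt d →L[ℝ] ℝ)) Finset.univ fun j _ => h j

theorem hasFDerivAt_gaussConv (q : Lp ℝ 2 (volume : Measure (Pt d))) (R : Poly d) (x₀ : Pt d) :
    HasFDerivAt (gaussConv q R)
      (∫ y, ∑ j, (gaussFun 1 (gaussOp 1 j R) (x₀ - y) * q y) •
        (EuclideanSpace.proj j : Pt d →L[ℝ] ℝ)) x₀ := by
  choose C hC hle using fun j => exists_abs_gaussFun_le (gaussOp 1 j R)
  refine hasFDerivAt_integral_of_dominated_of_fderiv_le
    (F := fun x y => gaussFun 1 R (x - y) * q y)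
    (F' := fun x y => ∑ j, (gaussFun 1 (gaussOp 1 j R) (x - y) * q y) •
        (EuclideanSpace.proj j : Pt d →L[ℝ] ℝ))
    (bound := fun y => ∑ j, C j * ‖(EuclideanSpace.proj j : Pt d →L[ℝ] ℝ)‖ *
      (Real.exp (-(1 / 4) * ‖x₀ - y‖ ^ 2) * ‖q y‖))
    (Metric.ball_mem_nhds x₀ one_pos)
    (Filter.Eventually.of_forall fun x => (integrable_gaussFun_mul q R x).aestronglyMeasurable)
    (integrable_gaussFun_mul q R x₀) ?_ ?_ ?_ ?_
  · exact (integrable_sum_gaussFun_smul q R x₀).aestronglyMeasurable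
  · refine Filter.Eventually.of_forall fun y x hx => (norm_sum_le _ _).trans ?_
    refine Finset.sum_le_sum fun j _ => ?_
    rw [norm_smul, norm_mul, Real.norm_eq_abs]
    have h1 := hle j (x - y) (x₀ - y) (by
      rw [sub_sub_sub_cancel_right, ← dist_eq_norm]; exact (Metric.mem_ball.1 hx).le)
    calc _ ≤ C j * Real.exp (-(1 / 4) * ‖x₀ - y‖ ^ 2) * ‖q y‖ *
          ‖(EuclideanSpace.proj j : Pt d →L[ℝ] ℝ)‖ := by gcongr
      _ = _ := by ring
  · refine integrable_finsetSum _ fun j _ => Integrable.const_mul ?_ _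
    exact (memLp_exp_neg_mul_sq_norm_sub (b := 1 / 4) (by norm_num) x₀).integrable_mul
      (Lp.memLp q).norm
  · refine Filter.Eventually.of_forall fun y x _ => ?_
    refine ((hasFDerivAt_gaussFun_sub 1 R x y).mul_const (q y)).congr_fderiv ?_
    simp only [Finset.smul_sum, smul_smul, mul_comm]

theorem partialD_gaussConv (q : Lp ℝ 2 (volume : Measure (Pt d))) (i : Fin d) (R : Poly d) :
    partialD i (gaussConv q R) = gaussConv q (gaussOp 1 i R) := by
  funext x₀
  rw [partialD, (hasFDerivAt_gaussConv q R x₀).fderiv,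
    ContinuousLinearMap.integral_apply (integrable_sum_gaussFun_smul q R x₀)]
  simp only [sum_smul_proj_apply_single]
  rfl

theorem multiD_gaussConv (q : Lp ℝ 2 (volume : Measure (Pt d))) (α : Fin d →₀ ℕ) (R : Poly d) :
    multiD α (gaussConv q R) = gaussConv q (iterOp (gaussOp 1) α R) :=
  iterOp_semiconj (Φ := gaussConv q) (partialD_gaussConv q) α R

theorem inner_toLp_gaussFun (q : Lp ℝ 2 (volume : Measure (Pt d))) (R : Poly d) (x : Pt d) :
    inner ℝ ((memLp_gaussFun_sub R x).toLp _) q = gaussConv q R x := by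
  rw [L2.inner_def]
  refine integral_congr_ae ?_
  filter_upwards [(memLp_gaussFun_sub R x).coeFn_toLp] with y hy
  rw [hy]
  simp [mul_comm]

theorem gaussianKernel_eq (x : Pt d) :
    gaussianKernel d x = (memLp_gaussFun_sub 1 x).toLp _ := by
  unfold gaussianKernel
  congr 1
  funext y
  simp [gaussFun, Poly.toFun]

theorem adjointMap_gaussianKernel (q : Lp ℝ 2 (volume : Measure (Pt d))) :
    adjointMap (gaussianKernel d) q = gaussConv q 1 := by
  funext x
  rw [adjointMap, gaussianKernel_eq, inner_toLp_gaussFun]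

/-- The functional `q ↦ ⟨P, Φ^* q⟩_B` is bounded on `L²`. -/
theorem exists_inner_eq_pairB (P : Poly d) :
    ∃ p : Lp ℝ 2 (volume : Measure (Pt d)),
      ∀ q, inner ℝ p q = pairB P (adjointMap (gaussianKernel d) q) := by
  refine ⟨∑ α ∈ P.support, MvPolynomial.coeff α P •
    (memLp_gaussFun_sub (iterOp (gaussOp 1) α 1) 0).toLp _, fun q => ?_⟩
  rw [sum_inner]
  refine Finset.sum_congr rfl fun α _ => ?_
  rw [real_inner_smul_left, inner_toLp_gaussFun, adjointMap_gaussianKernel, multiD_gaussConv]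

/-- The reproducing kernel is again a Gaussian, of doubled variance; completing the square gives
the constant `c = ∫ exp (-2 ‖u‖²)`. -/
theorem exists_inner_gaussianKernel (d : ℕ) :
    ∃ c : ℝ, 0 < c ∧ ∀ x y : Pt d,
      inner ℝ (gaussianKernel d x) (gaussianKernel d y) = c * gaussFun (1 / 2) 1 (x - y) := by
  have hint : Integrable (fun u : Pt d => Real.exp (-2 * ‖(0 : Pt d) - u‖ ^ 2)) :=
    integrable_exp_neg_mul_sq_norm_sub (b := 2) (by norm_num) 0
  refine ⟨∫ u : Pt d, Real.exp (-2 * ‖(0 : Pt d) - u‖ ^ 2), integral_exp_pos hint, fun x y => ?_⟩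
  rw [gaussianKernel_eq x, inner_toLp_gaussFun]
  have hy := (memLp_gaussFun_sub (1 : Poly d) y).coeFn_toLp
  rw [← gaussianKernel_eq] at hy
  have h1 : gaussConv (gaussianKernel d y) 1 x =
      ∫ u, gaussFun (1 / 2) 1 (x - y) *
        Real.exp (-2 * ‖(0 : Pt d) - (u - (1 / 2 : ℝ) • (x + y))‖ ^ 2) := by
    refine integral_congr_ae ?_
    filter_upwards [hy] with u hu
    rw [hu]
    simp only [gaussFun, Poly.toFun, map_one, one_mul, ← Real.exp_add]
    congr 1
    have hp := parallelogram_law_with_norm ℝ (x - u) (y - u)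
    have e1 : x - u + (y - u) = (2 : ℝ) • (0 - (u - (1 / 2 : ℝ) • (x + y))) := by module
    have e2 : x - u - (y - u) = x - y := by abel
    rw [e1, e2, norm_smul] at hp
    norm_num at hp ⊢
    linarith
  rw [h1, integral_const_mul, mul_comm]
  congr 1
  exact integral_sub_right_eq_self (fun u : Pt d => Real.exp (-2 * ‖(0 : Pt d) - u‖ ^ 2)) _

/-! ### Reduction of the minimal norm problem to a polynomial identity -/

/-- The Riesz representative of `q ↦ ⟨P, Φ^* q⟩_B` is mapped by `Φ^*` to a Hermite function, up
to the normalization `c` of the Gaussian kernel. -/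
theorem adjointMap_eq_hermite {c : ℝ}
    (hc : ∀ x y : Pt d, inner ℝ (gaussianKernel d x) (gaussianKernel d y) =
      c * gaussFun (1 / 2) 1 (x - y)) {P : Poly d} {p : Lp ℝ 2 (volume : Measure (Pt d))}
    (hp : ∀ q, inner ℝ p q = pairB P (adjointMap (gaussianKernel d) q)) :
    adjointMap (gaussianKernel d) p = fun x => c * gaussFun (1 / 2) (hermiteMap d P) x := by
  funext x
  have h1 : adjointMap (gaussianKernel d) (gaussianKernel d x) =
      fun y => c * gaussFun (1 / 2) 1 (y - x) := funext fun y => hc y x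
  rw [adjointMap, real_inner_comm, hp, h1, ← pairLin_apply]
  conv_lhs => rw [P.as_sum]
  have h2 : Poly.toFun (hermiteMap d P) x = ∑ α ∈ P.support, MvPolynomial.coeff α P *
      Poly.toFun (hermiteMap d (MvPolynomial.monomial α 1)) x := by
    conv_lhs => rw [P.as_sum]
    simp only [Poly.toFun, map_sum]
    refine Finset.sum_congr rfl fun α _ => ?_
    have h3 : MvPolynomial.monomial α (MvPolynomial.coeff α P) =
        MvPolynomial.coeff α P • MvPolynomial.monomial α (1 : ℝ) := by
      rw [MvPolynomial.smul_monomial, smul_eq_mul, mul_one]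
    rw [h3, map_smul, MvPolynomial.smul_eval]
  simp only [map_sum, pairLin_monomial, multiD_gaussFun, zero_sub]
  rw [gaussFun, h2, Finset.sum_mul, Finset.mul_sum]
  refine Finset.sum_congr rfl fun α _ => ?_
  rw [gaussFun, toFun_iterOp_gaussOp_neg, norm_neg]
  ring

theorem pairB_one (f : Pt d → ℝ) : pairB 1 f = f 0 := by
  have h := pairLin_monomial f 0 1
  rw [one_mul, pairLin_apply] at h
  refine h.trans (congrFun ?_ 0)
  unfold multiD
  simp

theorem toFun_zero (P : Poly d) : P.toFun 0 = MvPolynomial.constantCoeff P := by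
  rw [← MvPolynomial.eval_zero]
  rfl

/-- If `Q` is the Hermite transform of an element of `S_Z` and `Q(x) exp (-‖x‖² / 2)` satisfies
the constraints, then it is `η_{W,Z}`: its representer lies in the span of the constraint
functionals, hence is orthogonal to all differences of admissible elements. -/
theorem isEtaW_gaussFun {z : Fin N → Pt d} {P₀ Q : Poly d} (h1 : 1 ∈ hermiteLeast z)
    (hP₀ : P₀ ∈ hermiteLeast z) (hQ : hermiteMap d P₀ = Q)
    (hadm : ∀ P ∈ hermiteLeast z, pairB P (gaussFun (1 / 2) Q) = MvPolynomial.constantCoeff P) :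
    IsEtaW (gaussianKernel d) z (gaussFun (1 / 2) Q) := by
  obtain ⟨c, hc, hker⟩ := exists_inner_gaussianKernel d
  obtain ⟨p₀, hp₀⟩ := exists_inner_eq_pairB P₀
  have hadj₀ := adjointMap_eq_hermite hker hp₀
  have hadj : adjointMap (gaussianKernel d) (c⁻¹ • p₀) = gaussFun (1 / 2) Q := by
    funext x
    have := congrFun hadj₀ x
    rw [adjointMap] at this ⊢
    rw [real_inner_smul_right, this, hQ]
    field_simp
  have hmem : c⁻¹ • p₀ ∈ admissible (gaussianKernel d) z := by
    refine ⟨?_, fun P hP hP0 => ?_⟩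
    · rw [hadj, ← pairB_one (gaussFun (1 / 2) Q), hadm 1 h1, map_one]
    · rw [hadj]
      rw [toFun_zero] at hP0
      exact (hadm P hP).trans hP0
  have hpair : ∀ q ∈ admissible (gaussianKernel d) z,
      inner ℝ (c⁻¹ • p₀) q = c⁻¹ * MvPolynomial.constantCoeff P₀ := by
    intro q hq
    rw [real_inner_smul_left, hp₀]
    congr 1
    set f := adjointMap (gaussianKernel d) q
    have hdec : P₀ = (P₀ - MvPolynomial.constantCoeff P₀ • (1 : Poly d)) +
        MvPolynomial.constantCoeff P₀ • (1 : Poly d) := by abel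
    have h0 := hq.2 (P₀ - MvPolynomial.constantCoeff P₀ • (1 : Poly d))
      (Submodule.sub_mem _ hP₀ (Submodule.smul_mem _ _ h1)) (by
        rw [toFun_zero, map_sub, MvPolynomial.constantCoeff_smul, map_one]
        simp)
    rw [← pairLin_apply]
    conv_lhs => rw [hdec]
    rw [map_add, map_smul, pairLin_apply, pairLin_apply, pairB_one, show f 0 = 1 from hq.1]
    change diffOp _ f 0 + _ = _
    rw [h0]
    simp
  have hnorm : ∀ q ∈ admissible (gaussianKernel d) z,
      ‖q‖ ^ 2 = ‖c⁻¹ • p₀‖ ^ 2 + ‖q - c⁻¹ • p₀‖ ^ 2 := by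
    intro q hq
    rw [norm_sub_sq_real, ← real_inner_self_eq_norm_sq (c⁻¹ • p₀), hpair _ hmem,
      real_inner_comm, hpair q hq]
    ring
  refine ⟨c⁻¹ • p₀, ⟨hmem, fun q hq => ?_⟩, fun q hq => ?_, hadj.symm⟩
  · refine (sq_le_sq₀ (norm_nonneg _) (norm_nonneg _)).1 ?_
    rw [hnorm q hq]
    exact le_add_of_nonneg_right (sq_nonneg _)
  · have h2 := (sq_le_sq₀ (norm_nonneg _) (norm_nonneg _)).2 (hq.2 _ hmem)
    have h3 := hnorm q hq.1
    have h4 : ‖q - c⁻¹ • p₀‖ ^ 2 = 0 := le_antisymm (by linarith) (sq_nonneg _)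
    exact sub_eq_zero.1 (norm_eq_zero.1 (pow_eq_zero_iff (two_ne_zero) |>.1 h4))

/-! ### Testing the constraints on Taylor coefficients -/

theorem gaussSeries_zero : gaussSeries d 0 = 1 := by
  refine MvPowerSeries.pderiv.ext (fun i => ?_) ?_
  · rw [pderiv_gaussSeries, MvPowerSeries.pderiv_one]
    simp
  · rw [← MvPowerSeries.coeff_zero_eq_constantCoeff_apply, coeff_zero_gaussSeries, map_one]

theorem pairB_toFun (P R : Poly d) :
    pairB P R.toFun = ∑ α ∈ P.support, MvPolynomial.coeff α P *
      (multiFactorial α * MvPolynomial.coeff α R) := by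
  have h : gaussFun 0 R = R.toFun := by funext x; simp [gaussFun]
  rw [← h, pairB_gaussFun, gaussSeries_zero]
  simp

theorem pairB_expHalfSq (P : Poly d) :
    pairB P (expHalfSq d) = ∑ α ∈ P.support, MvPolynomial.coeff α P *
      (multiFactorial α * MvPowerSeries.coeff α (gaussSeries d (-(1 / 2)))) := by
  have h : gaussFun (-(1 / 2)) (1 : Poly d) = expHalfSq d := by
    funext x
    simp [gaussFun, expHalfSq, Poly.toFun]
    ring
  rw [← h, pairB_gaussFun]
  simp

theorem pairB_self_pos {P : Poly d} (hP : P ≠ 0) : 0 < pairB P P.toFun := by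
  rw [pairB_toFun]
  refine Finset.sum_pos (fun α hα => ?_) (MvPolynomial.support_nonempty.2 hP)
  have h1 := MvPolynomial.mem_support_iff.1 hα
  have h2 := multiFactorial_pos α
  have h3 : 0 < MvPolynomial.coeff α P * MvPolynomial.coeff α P := mul_self_pos.2 h1
  nlinarith

/-- If `Q` agrees with `exp (‖x‖² / 2)` in all coefficients strictly below the monomials of `P`,
then `Q(x) exp (-‖x‖² / 2)` is tested by `P` like
`1 + (Q - exp (‖x‖² / 2))`: multiplication by the Gaussian does not alter the lowest terms. -/
theorem pairB_gaussFun_half {P Q : Poly d}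
    (h : ∀ α ∈ P.support, ∀ β < α,
      MvPolynomial.coeff β Q = MvPowerSeries.coeff β (gaussSeries d (-(1 / 2)))) :
    pairB P (gaussFun (1 / 2) Q) =
      MvPolynomial.constantCoeff P + (pairB P Q.toFun - pairB P (expHalfSq d)) := by
  classical
  have hE : gaussSeries d (-(1 / 2)) * gaussSeries d (1 / 2) = 1 := by
    have := gaussSeries_mul_neg (d := d) (-(1 / 2))
    rwa [neg_neg] at this
  have hone : MvPolynomial.constantCoeff P = ∑ α ∈ P.support, MvPolynomial.coeff α P *
      (multiFactorial α * MvPowerSeries.coeff α (1 : MvPowerSeries (Fin d) ℝ)) := by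
    rw [MvPolynomial.constantCoeff_eq]
    simp only [MvPowerSeries.coeff_one, mul_ite, mul_one, mul_zero]
    rw [Finset.sum_ite_eq']
    split_ifs with h0
    · rw [multiFactorial_zero, mul_one]
    · exact MvPolynomial.notMem_support_iff.1 h0
  rw [pairB_gaussFun, pairB_toFun, pairB_expHalfSq, hone, ← Finset.sum_sub_distrib,
    ← Finset.sum_add_distrib]
  refine Finset.sum_congr rfl fun α hα => ?_
  have hdec : (Q : MvPowerSeries (Fin d) ℝ) * gaussSeries d (1 / 2) =
      1 + ((Q : MvPowerSeries (Fin d) ℝ) - gaussSeries d (-(1 / 2))) * gaussSeries d (1 / 2) := by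
    rw [sub_mul, hE]; ring
  rw [hdec, map_add, coeff_mul_of_forall_lt (coeff_zero_gaussSeries _), map_sub,
    MvPolynomial.coeff_coe]
  · ring
  · intro β hβ
    rw [map_sub, MvPolynomial.coeff_coe, h α hα β hβ, sub_self]

theorem pairB_gaussFun_half_of_forall_le {P Q : Poly d}
    (h : ∀ α ∈ P.support, ∀ β ≤ α,
      MvPolynomial.coeff β Q = MvPowerSeries.coeff β (gaussSeries d (-(1 / 2)))) :
    pairB P (gaussFun (1 / 2) Q) = MvPolynomial.constantCoeff P := by
  rw [pairB_gaussFun_half fun α hα β hβ => h α hα β hβ.le, pairB_toFun, pairB_expHalfSq,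
    Finset.sum_congr rfl fun α hα => by rw [h α hα α le_rfl], sub_self, add_zero]

/-! ### Least interpolant spaces that contain all polynomials of degree at most `L` -/

theorem isLowerSet_degree_le (d L : ℕ) : IsLowerSet {α : Fin d →₀ ℕ | α.degree ≤ L} :=
  fun _ _ h hα => (Finsupp.degree_mono h).trans hα

theorem degree_lt_degree {α β : Fin d →₀ ℕ} (h : β < α) : β.degree < α.degree := by
  obtain ⟨γ, rfl⟩ := exists_add_of_le h.le
  rw [map_add, Nat.lt_add_right_iff_pos, Nat.pos_iff_ne_zero, Ne, Finsupp.degree_eq_zero_iff]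
  rintro rfl
  simp at h

theorem restrictSupport_le_span_monomialsUpTo (d L : ℕ) :
    MvPolynomial.restrictSupport ℝ {α : Fin d →₀ ℕ | α.degree ≤ L} ≤
      Submodule.span ℝ (monomialsUpTo d L) := by
  rw [MvPolynomial.restrictSupport_eq_span]
  refine Submodule.span_mono ?_
  rintro _ ⟨α, hα, rfl⟩
  exact ⟨α, hα, rfl⟩

theorem one_mem_monomialsUpTo (d L : ℕ) : (1 : Poly d) ∈ monomialsUpTo d L :=
  ⟨0, by simp, rfl⟩

/-- The polynomial factor `Q` is the orthogonal projection of `exp (‖x‖² / 2)` onto `S_Z`. It agrees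
with `exp (‖x‖² / 2)` up to degree `L`, and in degree `L + 1` the difference is orthogonal to `S_Z`;
`S_Z` is stable under the Hermite map, which changes terms of degree at most `L` only. -/
theorem isEtaW_of_homogeneous_top (z : Fin N → Pt d) (L : ℕ) (B : Finset (Poly d))
    (R : Set (Poly d)) (hB : IsDeBoorBasis z B) (hR : ∀ P ∈ R, P.IsHomogeneous (L + 1))
    (hBR : (B : Set (Poly d)) = monomialsUpTo d L ∪ R) :
    IsEtaW (gaussianKernel d) z (fun x =>
      Real.exp (-‖x‖ ^ 2 / 2) *
        ∑ P ∈ B, pairB P (expHalfSq d) / pairB P P.toFun * P.toFun x) := by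
  set Q : Poly d := ∑ P ∈ B, (pairB P (expHalfSq d) / pairB P P.toFun) • P with hQdef
  have hfun : (fun x => Real.exp (-‖x‖ ^ 2 / 2) *
      ∑ P ∈ B, pairB P (expHalfSq d) / pairB P P.toFun * P.toFun x) = gaussFun (1 / 2) Q := by
    funext x
    rw [gaussFun, mul_comm, hQdef]
    congr 1
    · simp only [Poly.toFun, map_sum, MvPolynomial.smul_eval]
    · congr 1; ring
  rw [hfun]
  have hmonB : ∀ P ∈ monomialsUpTo d L, P ∈ B := fun P hP => by
    rw [← Finset.mem_coe, hBR]; exact Or.inl hP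
  have hspan : ∀ P ∈ B, P ∈ hermiteLeast z := fun P hP => by
    rw [← hB.span_eq]; exact Submodule.subset_span hP
  have hne : ∀ P ∈ B, P ≠ 0 := fun P hP => hB.linearIndep.ne_zero hP
  have hlow : MvPolynomial.restrictSupport ℝ {α : Fin d →₀ ℕ | α.degree ≤ L} ≤ hermiteLeast z :=
    (restrictSupport_le_span_monomialsUpTo d L).trans
      (Submodule.span_le.2 fun P hP => hspan P (hmonB P hP))
  have hcases : ∀ P ∈ B, P ∈ monomialsUpTo d L ∨ P ∈ R := fun P hP => by
    rw [← Finset.mem_coe, hBR] at hP; exact hP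
  -- Up to degree `L` the only basis element with a given monomial is this monomial itself.
  have hcoeff : ∀ β : Fin d →₀ ℕ, β.degree ≤ L →
      MvPolynomial.coeff β Q = MvPowerSeries.coeff β (gaussSeries d (-(1 / 2))) := by
    intro β hβ
    have hmem : MvPolynomial.monomial β (1 : ℝ) ∈ B := hmonB _ ⟨β, hβ, rfl⟩
    rw [hQdef, MvPolynomial.coeff_sum, Finset.sum_eq_single_of_mem _ hmem]
    · have h1 : (MvPolynomial.monomial β (1 : ℝ)).support = {β} := by
        rw [MvPolynomial.support_monomial, if_neg one_ne_zero]
      rw [pairB_expHalfSq, pairB_toFun, h1]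
      simp only [Finset.sum_singleton, MvPolynomial.coeff_smul, MvPolynomial.coeff_monomial,
        if_true, smul_eq_mul, one_mul, mul_one]
      exact mul_div_cancel_left₀ _ (multiFactorial_ne_zero β)
    · intro P hP hPne
      have h0 : MvPolynomial.coeff β P = 0 := by
        rcases hcases P hP with ⟨α, _, rfl⟩ | hPR
        · rw [MvPolynomial.coeff_monomial, if_neg]
          rintro rfl
          exact hPne rfl
        · exact (hR P hPR).coeff_eq_zero (by omega)
      rw [MvPolynomial.coeff_smul, h0, smul_zero]
  have hQmem : Q ∈ hermiteLeast z :=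
    Submodule.sum_mem _ fun P hP => Submodule.smul_mem _ _ (hspan P hP)
  have hQsupp : Q ∈ MvPolynomial.restrictSupport ℝ {α : Fin d →₀ ℕ | α.degree ≤ L + 1} := by
    refine Submodule.sum_mem _ fun P hP => Submodule.smul_mem _ _ ?_
    rcases hcases P hP with ⟨α, hα, rfl⟩ | hPR
    · exact (MvPolynomial.monomial_mem_restrictSupport ℝ).2 (Or.inl (Nat.le_succ_of_le hα))
    · refine mem_restrictSupport_iff_coeff.2 fun β hβ => ?_
      by_contra hlt
      exact hβ ((hR P hPR).coeff_eq_zero fun h => hlt h.le)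
  obtain ⟨P₁, hP₁, hP₁eq⟩ := exists_hermiteMap_eq (isLowerSet_degree_le d L)
    (hermiteMap_sub_mem (D' := {α : Fin d →₀ ℕ | α.degree ≤ L})
      (fun α hα β hβ => Nat.le_of_lt_succ ((degree_lt_degree hβ).trans_le hα)) hQsupp)
  refine isEtaW_gaussFun (P₀ := Q - P₁) (hspan _ (hmonB _ (one_mem_monomialsUpTo d L)))
    (Submodule.sub_mem _ hQmem (hlow hP₁)) (by rw [map_sub, hP₁eq]; abel) ?_
  have hbasis : ∀ P ∈ B, pairB P (gaussFun (1 / 2) Q) = MvPolynomial.constantCoeff P := by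
    intro P hP
    rcases hcases P hP with ⟨α, hα, rfl⟩ | hPR
    · refine pairB_gaussFun_half_of_forall_le fun γ hγ β hβ => hcoeff β ?_
      rw [MvPolynomial.support_monomial, if_neg one_ne_zero, Finset.mem_singleton] at hγ
      subst hγ
      exact (Finsupp.degree_mono hβ).trans hα
    · have hdeg : ∀ α ∈ P.support, α.degree = L + 1 := fun α hα => by
        by_contra hne
        exact MvPolynomial.mem_support_iff.1 hα ((hR P hPR).coeff_eq_zero hne)
      rw [pairB_gaussFun_half fun α hα β hβ => hcoeff β ?_]
      · -- `Q` is the orthogonal projection of `exp (‖x‖² / 2)` onto the span of `B`.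
        have hproj : pairB P Q.toFun = pairB P (expHalfSq d) := by
          have hlin : pairB P Q.toFun = ∑ P' ∈ B,
              (pairB P' (expHalfSq d) / pairB P' P'.toFun) * pairB P P'.toFun := by
            simp only [pairB_toFun P, hQdef, MvPolynomial.coeff_sum, MvPolynomial.coeff_smul,
              smul_eq_mul, Finset.mul_sum]
            rw [Finset.sum_comm]
            refine Finset.sum_congr rfl fun P' _ => Finset.sum_congr rfl fun α _ => ?_
            ring
          rw [hlin, Finset.sum_eq_single_of_mem P hP]
          · exact div_mul_cancel₀ _ (pairB_self_pos (hne P hP)).ne'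
          · intro P' hP' hPP'
            rw [hB.orthogonal P hP P' hP' hPP'.symm, mul_zero]
        rw [hproj, sub_self, add_zero]
      · have h1 := degree_lt_degree hβ
        rw [hdeg α hα] at h1
        omega
  intro P hP
  rw [← hB.span_eq] at hP
  induction hP using Submodule.span_induction with
  | mem P hP => exact hbasis P hP
  | zero => simp [← pairLin_apply]
  | add P P' _ _ h h' =>
    rw [← pairLin_apply] at h h' ⊢
    rw [map_add, map_add, h, h']
  | smul c P _ h =>
    rw [← pairLin_apply] at h ⊢
    rw [map_smul, h, MvPolynomial.constantCoeff_smul]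

/-- Here the polynomial factor is the Taylor polynomial of `exp (‖x‖² / 2)` of degree `L`. -/
theorem isEtaW_of_monomials (z : Fin N → Pt d) (L : ℕ) (B : Finset (Poly d))
    (hB : IsDeBoorBasis z B) (hBL : (B : Set (Poly d)) = monomialsUpTo d L) :
    IsEtaW (gaussianKernel d) z (fun x =>
      Real.exp (-‖x‖ ^ 2 / 2) *
        ∑ α ∈ (Fintype.piFinset fun _ : Fin d => Finset.range (L + 1)) with
            2 * ∑ i, α i ≤ L,
          (∏ i, x i ^ (2 * α i)) / ((2 : ℝ) ^ (∑ i, α i) * ∏ i, ((α i).factorial : ℝ))) := by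
  classical
  set F : Finset (Fin d → ℕ) :=
    {α ∈ Fintype.piFinset fun _ : Fin d => Finset.range (L + 1) | 2 * ∑ i, α i ≤ L} with hF
  -- All exponents in the Taylor series of `exp (‖x‖² / 2)` are even: `e α = 2 α`.
  let e : (Fin d → ℕ) → (Fin d →₀ ℕ) := fun α => Finsupp.equivFunOnFinite.symm fun i => 2 * α i
  have he : ∀ α i, e α i = 2 * α i := fun α i => rfl
  set Q : Poly d := ∑ α ∈ F, MvPolynomial.monomial (e α)
    (((2 : ℝ) ^ (∑ i, α i) * ∏ i, ((α i).factorial : ℝ))⁻¹) with hQdef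
  have hfun : (fun x : Pt d => Real.exp (-‖x‖ ^ 2 / 2) *
      ∑ α ∈ F, (∏ i, x i ^ (2 * α i)) / ((2 : ℝ) ^ (∑ i, α i) * ∏ i, ((α i).factorial : ℝ))) =
        gaussFun (1 / 2) Q := by
    funext x
    rw [gaussFun, mul_comm, hQdef]
    congr 1
    · simp only [Poly.toFun, map_sum, MvPolynomial.eval_monomial]
      refine Finset.sum_congr rfl fun α _ => ?_
      rw [Finsupp.prod_fintype _ _ (fun i => pow_zero _), div_eq_inv_mul]
      rfl
    · congr 1; ring
  rw [hfun]
  have hdeg : ∀ α : Fin d → ℕ, (e α).degree = 2 * ∑ i, α i := fun α => by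
    rw [Finsupp.degree_eq_sum, Finset.mul_sum]
    rfl
  have hcoeff : ∀ β : Fin d →₀ ℕ, β.degree ≤ L →
      MvPolynomial.coeff β Q = MvPowerSeries.coeff β (gaussSeries d (-(1 / 2))) := by
    intro β hβ
    rw [hQdef, MvPolynomial.coeff_sum, coeff_gaussSeries]
    simp only [MvPolynomial.coeff_monomial]
    by_cases hev : ∀ i, Even (β i)
    · choose γ hγ using hev
      have hβe : e γ = β := by
        ext i
        rw [he, hγ i, two_mul]
      have hγF : γ ∈ F := by
        rw [hF, Finset.mem_filter, Fintype.mem_piFinset]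
        have h1 : 2 * ∑ i, γ i ≤ L := by rw [← hdeg, hβe]; exact hβ
        refine ⟨fun i => Finset.mem_range.2 ?_, h1⟩
        have := Finset.single_le_sum (f := γ) (fun j _ => Nat.zero_le _) (Finset.mem_univ i)
        omega
      rw [Finset.sum_eq_single_of_mem γ hγF, if_pos hβe]
      · rw [mul_inv, ← Finset.prod_pow_eq_pow_sum, ← Finset.prod_inv_distrib,
          ← Finset.prod_inv_distrib, ← Finset.prod_mul_distrib]
        refine Finset.prod_congr rfl fun i _ => ?_
        rw [hγ i, ← two_mul, gaussCoeff_two_mul, neg_neg, one_div, inv_pow, div_eq_mul_inv]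
      · intro α _ hα
        rw [if_neg]
        intro h
        refine hα (funext fun i => ?_)
        have := DFunLike.congr_fun (h.trans hβe.symm) i
        rw [he, he] at this
        omega
    · push Not at hev
      obtain ⟨i, hi⟩ := hev
      rw [Finset.prod_eq_zero (Finset.mem_univ i)
        (gaussCoeff_odd _ (by simpa using hi))]
      refine Finset.sum_eq_zero fun α _ => if_neg ?_
      rintro rfl
      exact hi (by rw [he]; exact even_two_mul (α i))
  have hspan : hermiteLeast z ≤ MvPolynomial.restrictSupport ℝ {α : Fin d →₀ ℕ | α.degree ≤ L} := by
    rw [← hB.span_eq, hBL, Submodule.span_le]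
    rintro _ ⟨α, hα, rfl⟩
    exact (MvPolynomial.monomial_mem_restrictSupport ℝ).2 (Or.inl hα)
  have hle : MvPolynomial.restrictSupport ℝ {α : Fin d →₀ ℕ | α.degree ≤ L} ≤ hermiteLeast z := by
    rw [← hB.span_eq, hBL]
    exact restrictSupport_le_span_monomialsUpTo d L
  have hQsupp : Q ∈ MvPolynomial.restrictSupport ℝ {α : Fin d →₀ ℕ | α.degree ≤ L} := by
    refine Submodule.sum_mem _ fun α hα => ?_
    refine (MvPolynomial.monomial_mem_restrictSupport ℝ).2 (Or.inl ?_)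
    rw [Set.mem_ofPred_eq, hdeg]
    exact (Finset.mem_filter.1 hα).2
  obtain ⟨P₀, hP₀, hP₀Q⟩ := exists_hermiteMap_eq (isLowerSet_degree_le d L) hQsupp
  refine isEtaW_gaussFun (hle ?_) (hle hP₀) hP₀Q fun P hP => ?_
  · exact (MvPolynomial.monomial_mem_restrictSupport ℝ).2 (Or.inl (by simp))
  · exact pairB_gaussFun_half_of_forall_le fun α hα β hβ => hcoeff β
      (isLowerSet_degree_le d L hβ (hspan hP hα))

/-! ### The exponential space through functionals -/

/-- The map `F ↦ g_F` as a linear map. -/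
def expSeriesLin (d : ℕ) : Module.Dual ℝ (Poly d) →ₗ[ℝ] MvPowerSeries (Fin d) ℝ where
  toFun := expSeries
  map_add' F G := by
    ext α
    change (F + G) _ / _ = F _ / _ + G _ / _
    rw [LinearMap.add_apply, add_div]
  map_smul' c F := by
    ext α
    change (c • F) _ / _ = c * (F _ / _)
    rw [LinearMap.smul_apply, smul_eq_mul, mul_div_assoc]

theorem mem_expSpace_iff {𝓕 : Set (Module.Dual ℝ (Poly d))} {g : MvPowerSeries (Fin d) ℝ} :
    g ∈ expSpace 𝓕 ↔ ∃ F ∈ Submodule.span ℝ 𝓕, expSeries F = g := by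
  have h : expSpace 𝓕 = (Submodule.span ℝ 𝓕).map (expSeriesLin d) := by
    rw [Submodule.map_span]
    rfl
  rw [h]
  rfl

theorem coeff_expSeries (F : Module.Dual ℝ (Poly d)) (α : Fin d →₀ ℕ) :
    MvPowerSeries.coeff α (expSeries F) =
      F (MvPolynomial.monomial α 1) / multiFactorial α := rfl

/-- `finsuppAntidiag` enumerates the multi-indices of degree `g.order`; for `g = 0` both sides
vanish. -/
theorem coeff_leastTerm (g : MvPowerSeries (Fin d) ℝ) (α : Fin d →₀ ℕ) :
    MvPolynomial.coeff α (leastTerm g) =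
      if α.degree = g.order.toNat then MvPowerSeries.coeff α g else 0 := by
  classical
  rw [leastTerm, MvPolynomial.coeff_sum]
  simp only [MvPolynomial.coeff_monomial]
  rw [Finset.sum_ite_eq']
  simp [Finset.mem_finsuppAntidiag, Finsupp.degree_eq_sum]

/-! ### Leading monomials -/

/-- `P` is the monomial `X^α` plus terms of degree less than `|α|`. -/
def HasLead (P : Poly d) (α : Fin d →₀ ℕ) : Prop :=
  P - MvPolynomial.monomial α 1 ∈ MvPolynomial.restrictSupport ℝ {β | β.degree < α.degree}

theorem hasLead_monomial (α : Fin d →₀ ℕ) : HasLead (MvPolynomial.monomial α 1) α := by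
  rw [HasLead, sub_self]
  exact Submodule.zero_mem _

theorem hasLead_X_sub_C (k : Fin d) (c : ℝ) :
    HasLead (MvPolynomial.X k - MvPolynomial.C c) (Finsupp.single k 1) := by
  have h : MvPolynomial.X k - MvPolynomial.C c - MvPolynomial.monomial (Finsupp.single k 1) 1 =
      -(MvPolynomial.monomial (0 : Fin d →₀ ℕ) c) := by
    rw [MvPolynomial.X, MvPolynomial.C_apply]; ring
  rw [HasLead, h]
  refine Submodule.neg_mem _ ((MvPolynomial.monomial_mem_restrictSupport ℝ).2 (Or.inl ?_))
  simp

theorem HasLead.mem {P : Poly d} {α : Fin d →₀ ℕ} (h : HasLead P α) :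
    P ∈ MvPolynomial.restrictSupport ℝ {β : Fin d →₀ ℕ | β.degree ≤ α.degree} := by
  have h1 : P = (P - MvPolynomial.monomial α 1) + MvPolynomial.monomial α 1 := by ring
  rw [h1]
  refine Submodule.add_mem _ (MvPolynomial.restrictSupport_mono ℝ (fun β hβ => ?_) h) ?_
  · exact le_of_lt (α := ℕ) hβ
  · exact (MvPolynomial.monomial_mem_restrictSupport ℝ).2 (Or.inl (le_refl α.degree))

theorem HasLead.mul {P P' : Poly d} {α α' : Fin d →₀ ℕ} (h : HasLead P α) (h' : HasLead P' α') :
    HasLead (P * P') (α + α') := by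
  have key : ∀ {A A' : Poly d} {D D' : Set (Fin d →₀ ℕ)},
      A ∈ MvPolynomial.restrictSupport ℝ D → A' ∈ MvPolynomial.restrictSupport ℝ D' →
      (∀ β ∈ D, ∀ β' ∈ D', (β + β').degree < (α + α').degree) →
      A * A' ∈ MvPolynomial.restrictSupport ℝ {β | β.degree < (α + α').degree} := by
    intro A A' D D' hA hA' hDD
    have := Submodule.mul_mem_mul hA hA'
    rw [← MvPolynomial.restrictSupport_add] at this
    refine MvPolynomial.restrictSupport_mono ℝ ?_ this
    rintro _ ⟨β, hβ, β', hβ', rfl⟩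
    exact hDD β hβ β' hβ'
  have hdec : P * P' - MvPolynomial.monomial (α + α') 1 =
      (P - MvPolynomial.monomial α 1) * P' +
        MvPolynomial.monomial α 1 * (P' - MvPolynomial.monomial α' 1) := by
    have : MvPolynomial.monomial (α + α') (1 : ℝ) =
        MvPolynomial.monomial α 1 * MvPolynomial.monomial α' 1 := by
      rw [MvPolynomial.monomial_mul, one_mul]
    rw [this]
    ring
  rw [HasLead, hdec]
  refine Submodule.add_mem _ (key h h'.mem ?_) (key (hasLead_monomial α).mem h' ?_)
  · intro β hβ β' hβ'
    simp only [map_add, Set.mem_ofPred_eq] at *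
    omega
  · intro β hβ β' hβ'
    simp only [map_add, Set.mem_ofPred_eq] at *
    omega

theorem hasLead_prod_X_sub_C {ι : Type*} (k : Fin d) (t : ι → ℝ) (s : Finset ι) :
    HasLead (∏ i ∈ s, (MvPolynomial.X k - MvPolynomial.C (t i))) (Finsupp.single k s.card) := by
  classical
  induction s using Finset.induction_on with
  | empty => simpa using hasLead_monomial (0 : Fin d →₀ ℕ)
  | insert i s hi ih =>
    rw [Finset.prod_insert hi, Finset.card_insert_of_notMem hi, add_comm, Finsupp.single_add]
    exact (hasLead_X_sub_C k (t i)).mul ih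

/-- A functional that annihilates a polynomial with leading monomial `X^α` has no term `X^α` in
its least term, because it annihilates all polynomials of smaller degree as well. -/
theorem coeff_leastTerm_eq_zero {F : Module.Dual ℝ (Poly d)} {P : Poly d} {α : Fin d →₀ ℕ}
    (hP : HasLead P α) (hF : F P = 0) :
    MvPolynomial.coeff α (leastTerm (expSeries F)) = 0 := by
  rw [coeff_leastTerm]
  split_ifs with hα
  · have hlow : MvPolynomial.restrictSupport ℝ {β : Fin d →₀ ℕ | β.degree < α.degree} ≤
        LinearMap.ker F := by
      rw [MvPolynomial.restrictSupport_eq_span, Submodule.span_le]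
      rintro _ ⟨β, hβ, rfl⟩
      have h1 : (β.degree : ℕ∞) < (expSeries F).order := by
        refine lt_of_lt_of_le ?_ (ENat.natCast_toNat_le_self _)
        rw [← hα]
        exact_mod_cast hβ
      have h2 := MvPowerSeries.coeff_of_lt_order h1
      rw [coeff_expSeries, div_eq_zero_iff] at h2
      exact h2.resolve_right (multiFactorial_ne_zero β)
    have h3 : F (P - MvPolynomial.monomial α 1) = 0 := hlow hP
    rw [map_sub, hF, zero_sub, neg_eq_zero] at h3
    rw [coeff_expSeries, h3, zero_div]
  · rfl

/-- Hermite functionals annihilate the multiples of `W²` if `W` vanishes at the positions. -/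
theorem apply_mul_self_mul_eq_zero {z : Fin N → Pt d} {W : Poly d} (hW : ∀ i, evalAt (z i) W = 0)
    (q : Poly d) {F : Module.Dual ℝ (Poly d)}
    (hF : F ∈ Submodule.span ℝ (hermiteFunctionals z)) : F (W * W * q) = 0 := by
  have hmul : ∀ (a : Pt d) (A A' : Poly d), evalAt a (A * A') = evalAt a A * evalAt a A' :=
    fun a A A' => map_mul (MvPolynomial.aeval fun i => a i) A A'
  induction hF using Submodule.span_induction with
  | mem F hF =>
    obtain ⟨i, rfl | ⟨k, rfl⟩⟩ := hF
    · rw [hmul, hmul, hW i]; simp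
    · change evalAt (z i) (MvPolynomial.pderiv k (W * W * q)) = 0
      rw [MvPolynomial.pderiv_mul, MvPolynomial.pderiv_mul]
      simp only [map_add, hmul, hW i]
      simp
  | zero => rfl
  | add F G _ _ hF hG => rw [LinearMap.add_apply, hF, hG, add_zero]
  | smul c F _ hF => rw [LinearMap.smul_apply, hF, smul_zero]

/-! ### Positions on a line parallel to a coordinate axis -/

theorem evalAt_X_sub_C (a : Pt d) (k : Fin d) (c : ℝ) :
    evalAt a (MvPolynomial.X k - MvPolynomial.C c) = a k - c := by
  simp [evalAt]

/-- If `α k ≥ 2N` or `α l ≥ 2` with `l ≠ k`, there is a polynomial `W² q` with leading monomial `X^α`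
and `W` vanishing at all positions: `W` is the product of the `X_k - z i k`, respectively
`X_l` minus the common `l`-th coordinate. -/
theorem hermiteLeast_le_of_line {z : Fin N → Pt d} (hN : 0 < N) {k : Fin d}
    (hline : ∀ i j : Fin N, ∀ l : Fin d, l ≠ k → z i l = z j l) :
    hermiteLeast z ≤
      MvPolynomial.restrictSupport ℝ {α | α k < 2 * N ∧ ∀ l, l ≠ k → α l ≤ 1} := by
  refine Submodule.span_le.2 ?_
  rintro _ ⟨g, hg, rfl⟩
  obtain ⟨F, hF, rfl⟩ := mem_expSpace_iff.1 hg
  refine mem_restrictSupport_iff_coeff.2 fun α hα => ⟨?_, fun l hl => ?_⟩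
  · by_contra hk
    refine hα (coeff_leastTerm_eq_zero (P := (∏ i, (MvPolynomial.X k - MvPolynomial.C (z i k))) *
      (∏ i, (MvPolynomial.X k - MvPolynomial.C (z i k))) *
        MvPolynomial.monomial (α - (Finsupp.single k N + Finsupp.single k N)) 1) ?_
      (apply_mul_self_mul_eq_zero (fun i => ?_) _ hF))
    · have h1 := hasLead_prod_X_sub_C k (fun i => z i k) Finset.univ
      rw [Finset.card_univ, Fintype.card_fin] at h1
      have h2 := (h1.mul h1).mul
        (hasLead_monomial (α - (Finsupp.single k N + Finsupp.single k N)))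
      rwa [add_tsub_cancel_of_le] at h2
      rw [← Finsupp.single_add, Finsupp.single_le_iff]
      omega
    · have h1 : evalAt (z i) (∏ j, (MvPolynomial.X k - MvPolynomial.C (z j k))) =
          ∏ j, evalAt (z i) (MvPolynomial.X k - MvPolynomial.C (z j k)) :=
        map_prod (MvPolynomial.aeval fun l => z i l) _ _
      rw [h1]
      refine Finset.prod_eq_zero (Finset.mem_univ i) ?_
      rw [evalAt_X_sub_C, sub_self]
  · by_contra hl2
    refine hα (coeff_leastTerm_eq_zero
      (P := (MvPolynomial.X l - MvPolynomial.C (z ⟨0, hN⟩ l)) *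
        (MvPolynomial.X l - MvPolynomial.C (z ⟨0, hN⟩ l)) *
        MvPolynomial.monomial (α - (Finsupp.single l 1 + Finsupp.single l 1)) 1) ?_
      (apply_mul_self_mul_eq_zero (fun i => ?_) _ hF))
    · have h1 := hasLead_X_sub_C l (z ⟨0, hN⟩ l)
      have h2 := (h1.mul h1).mul
        (hasLead_monomial (α - (Finsupp.single l 1 + Finsupp.single l 1)))
      rwa [add_tsub_cancel_of_le] at h2
      rw [← Finsupp.single_add, Finsupp.single_le_iff]
      omega
    · rw [evalAt_X_sub_C, hline i ⟨0, hN⟩ l hl, sub_self]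

/-- Univariate Hermite interpolation is unisolvent on polynomials of degree less than `2N`. -/
theorem eq_zero_of_forall_double_root {t : Fin N → ℝ} (ht : Function.Injective t)
    {p : Polynomial ℝ} (hp : p.degree < (2 * N : ℕ)) (h0 : ∀ i, p.eval (t i) = 0)
    (h1 : ∀ i, p.derivative.eval (t i) = 0) : p = 0 := by
  by_contra hne
  have hdvd : ∏ i, (Polynomial.X - Polynomial.C (t i)) ^ 2 ∣ p := by
    refine Finset.prod_dvd_of_coprime (fun i _ j _ hij => ?_) fun i _ => ?_
    · exact (Polynomial.isCoprime_X_sub_C_of_isUnit_sub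
        (sub_ne_zero.2 (ht.ne hij)).isUnit).pow
    · rw [← Polynomial.le_rootMultiplicity_iff hne]
      exact (Polynomial.one_lt_rootMultiplicity_iff_isRoot hne).2 ⟨h0 i, h1 i⟩
  refine hne (Polynomial.eq_zero_of_dvd_of_degree_lt hdvd ?_)
  rw [Polynomial.degree_prod]
  simpa [Polynomial.degree_pow, mul_comm] using hp

/-- By duality, every coefficient of a polynomial of degree less than `2N` is a combination of its
values and derivatives at `N` distinct points. -/
theorem exists_hermite_coeff {t : Fin N → ℝ} (ht : Function.Injective t) (n : ℕ) :
    ∃ b c : Fin N → ℝ, ∀ m < 2 * N,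
      ∑ i, (b i * t i ^ m + c i * (m * t i ^ (m - 1))) = if m = n then 1 else 0 := by
  let V := Polynomial.degreeLT ℝ (2 * N)
  let val : Fin N → (V →ₗ[ℝ] ℝ) := fun i => (Polynomial.leval (t i)).comp V.subtype
  let der : Fin N → (V →ₗ[ℝ] ℝ) := fun i =>
    ((Polynomial.leval (t i)).comp Polynomial.derivative).comp V.subtype
  let K : V →ₗ[ℝ] ℝ := (Polynomial.lcoeff ℝ n).comp V.subtype
  have hmem : K ∈ Submodule.span ℝ (Set.range (Sum.elim val der)) := by
    refine mem_span_of_iInf_ker_le_ker fun p hp => ?_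
    rw [Submodule.mem_iInf] at hp
    have h : (p : Polynomial ℝ) = 0 := eq_zero_of_forall_double_root ht
      (Polynomial.mem_degreeLT.1 p.2) (fun i => hp (Sum.inl i)) (fun i => hp (Sum.inr i))
    change (p : Polynomial ℝ).coeff n = 0
    rw [h, Polynomial.coeff_zero]
  obtain ⟨a, ha⟩ := (Submodule.mem_span_range_iff_exists_fun ℝ).1 hmem
  refine ⟨fun i => a (Sum.inl i), fun i => a (Sum.inr i), fun m hm => ?_⟩
  let p : V := ⟨Polynomial.X ^ m, Polynomial.mem_degreeLT.2 (by
    rw [Polynomial.degree_X_pow]; exact_mod_cast hm)⟩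
  have h := LinearMap.congr_fun ha p
  rw [Fintype.sum_sum_type] at h
  simp only [LinearMap.add_apply, LinearMap.sum_apply, LinearMap.smul_apply, Sum.elim_inl,
    Sum.elim_inr, smul_eq_mul] at h
  have hv : ∀ i, val i p = t i ^ m := fun i => by simp [val, p]
  have hd : ∀ i, der i p = m * t i ^ (m - 1) := fun i => by
    simp [der, p, Polynomial.derivative_X_pow]
  have hK : K p = if m = n then 1 else 0 := by
    simp [K, p, Polynomial.coeff_X_pow, eq_comm]
  simp only [hv, hd, hK] at h
  rw [← h, Finset.sum_add_distrib]

theorem evalAt_monomial (a : Pt d) (α : Fin d →₀ ℕ) (c : ℝ) :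
    evalAt a (MvPolynomial.monomial α c) = c * ∏ i, a i ^ α i := by
  change MvPolynomial.aeval (fun i => a i) (MvPolynomial.monomial α c) = _
  rw [MvPolynomial.aeval_monomial, Finsupp.prod_fintype _ _ fun i => pow_zero _]
  rfl

/-- The functional that picks the coefficient of `X_k ^ n` on the line has `X_k ^ n` as least term,
up to a factor. -/
theorem monomial_single_mem_hermiteLeast {z : Fin N → Pt d} (hz : Function.Injective z) {k : Fin d}
    (hline : ∀ i j : Fin N, ∀ l : Fin d, l ≠ k → z i l = z j l) {n : ℕ} (hn : n < 2 * N) :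
    MvPolynomial.monomial (Finsupp.single k n) (1 : ℝ) ∈ hermiteLeast z := by
  have hN : 0 < N := by omega
  have ht : Function.Injective fun i => z i k := fun i j hij => by
    refine hz (PiLp.ext fun l => ?_)
    by_cases hl : l = k
    · rw [hl]; exact hij
    · exact hline i j l hl
  obtain ⟨b, c, hbc⟩ := exists_hermite_coeff ht n
  let F : Module.Dual ℝ (Poly d) :=
    ∑ i, (b i • evalAt (z i) + c i • evalPartialAt (z i) k)
  have hF : F ∈ Submodule.span ℝ (hermiteFunctionals z) :=
    Submodule.sum_mem _ fun i _ => Submodule.add_mem _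
      (Submodule.smul_mem _ _ (Submodule.subset_span ⟨i, Or.inl rfl⟩))
      (Submodule.smul_mem _ _ (Submodule.subset_span ⟨i, Or.inr ⟨k, rfl⟩⟩))
  -- Off the `k`-th coordinate a monomial is constant on the line.
  have hval : ∀ α : Fin d →₀ ℕ, α k < 2 * N → F (MvPolynomial.monomial α 1) =
      (∏ l ∈ Finset.univ.erase k, z ⟨0, hN⟩ l ^ α l) * if α k = n then 1 else 0 := by
    intro α hα
    have hoff : ∀ i, ∏ l ∈ Finset.univ.erase k, z i l ^ α l =
        ∏ l ∈ Finset.univ.erase k, z ⟨0, hN⟩ l ^ α l := fun i =>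
      Finset.prod_congr rfl fun l hl => by rw [hline i ⟨0, hN⟩ l (Finset.ne_of_mem_erase hl)]
    have hoff' : ∀ i, ∏ l ∈ Finset.univ.erase k, z i l ^ (α - Finsupp.single k 1 : Fin d →₀ ℕ) l =
        ∏ l ∈ Finset.univ.erase k, z ⟨0, hN⟩ l ^ α l := fun i => by
      rw [← hoff i]
      refine Finset.prod_congr rfl fun l hl => ?_
      simp [(Finset.ne_of_mem_erase hl).symm]
    rw [← hbc (α k) hα, Finset.mul_sum]
    simp only [F, LinearMap.sum_apply, LinearMap.add_apply, LinearMap.smul_apply, smul_eq_mul]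
    refine Finset.sum_congr rfl fun i _ => ?_
    have hp : evalPartialAt (z i) k (MvPolynomial.monomial α 1) =
        evalAt (z i) (MvPolynomial.pderiv k (MvPolynomial.monomial α 1)) := rfl
    rw [hp, MvPolynomial.pderiv_monomial, evalAt_monomial, evalAt_monomial,
      ← Finset.mul_prod_erase _ _ (Finset.mem_univ k), hoff i,
      ← Finset.mul_prod_erase _ (fun l => z i l ^ (α - Finsupp.single k 1 : Fin d →₀ ℕ) l) (Finset.mem_univ k),
      hoff' i]
    have hk : (α - Finsupp.single k 1 : Fin d →₀ ℕ) k = α k - 1 := by simp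
    rw [hk]
    ring
  have hcoord : ∀ α : Fin d →₀ ℕ, α k ≤ α.degree := fun α => Finsupp.le_degree k α
  have hlead : F (MvPolynomial.monomial (Finsupp.single k n) 1) = 1 := by
    rw [hval _ (by simpa using hn), Finsupp.single_eq_same, if_pos rfl, mul_one]
    refine Finset.prod_eq_one fun l hl => ?_
    simp [(Finset.ne_of_mem_erase hl).symm]
  have hord : (expSeries F).order = n := by
    refine MvPowerSeries.order_eq_nat.2 ⟨⟨Finsupp.single k n, ?_, Finsupp.degree_single k n⟩, ?_⟩
    · rw [coeff_expSeries, hlead]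
      exact div_ne_zero one_ne_zero (multiFactorial_ne_zero _)
    · intro α hα
      have := hcoord α
      rw [coeff_expSeries, hval α (by omega), if_neg (by omega), mul_zero, zero_div]
  have hleast : leastTerm (expSeries F) = (multiFactorial (Finsupp.single k n))⁻¹ •
      MvPolynomial.monomial (Finsupp.single k n) (1 : ℝ) := by
    ext α
    rw [coeff_leastTerm, hord, ENat.toNat_natCast, MvPolynomial.coeff_smul,
      MvPolynomial.coeff_monomial]
    by_cases hα : Finsupp.single k n = α
    · subst hα
      rw [if_pos (Finsupp.degree_single k n), if_pos rfl, coeff_expSeries, hlead, one_div,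
        smul_eq_mul, mul_one]
    · rw [if_neg hα, smul_zero]
      split_ifs with hdeg
      · have hk : α k ≠ n := by
          intro hk
          have hle : Finsupp.single k n ≤ α := by rw [Finsupp.single_le_iff, hk]
          have := degree_lt_degree (lt_of_le_of_ne hle hα)
          rw [Finsupp.degree_single, hdeg] at this
          exact lt_irrefl _ this
        have := hcoord α
        rw [coeff_expSeries, hval α (by omega), if_neg hk, mul_zero, zero_div]
      · rfl
  have hmem : leastTerm (expSeries F) ∈ hermiteLeast z :=
    Submodule.subset_span ⟨_, mem_expSpace_iff.2 ⟨F, hF, rfl⟩, rfl⟩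
  rw [hleast] at hmem
  exact (Submodule.smul_mem_iff _ (inv_ne_zero (multiFactorial_ne_zero _))).1 hmem

/-- Here `S_Z` lies between the span of the `X_k ^ j`, `j < 2N`, and the polynomials of degree less
than `2N` in `X_k` and at most `1` in each other variable; among the latter exponents the series
`exp (‖x‖² / 2)` only has powers of `X_k ^ 2`. -/
theorem isEtaW_of_line {z : Fin N → Pt d} (hN : 0 < N) (hz : Function.Injective z) {k : Fin d}
    (hline : ∀ i j : Fin N, ∀ l : Fin d, l ≠ k → z i l = z j l) :
    IsEtaW (gaussianKernel d) z (fun x =>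
      Real.exp (-‖x‖ ^ 2 / 2) *
        ∑ j ∈ Finset.range N, x k ^ (2 * j) / ((2 : ℝ) ^ j * (j.factorial : ℝ))) := by
  classical
  set Q : Poly d := ∑ j ∈ Finset.range N, MvPolynomial.monomial (Finsupp.single k (2 * j))
    (((2 : ℝ) ^ j * (j.factorial : ℝ))⁻¹) with hQdef
  have hfun : (fun x : Pt d => Real.exp (-‖x‖ ^ 2 / 2) *
      ∑ j ∈ Finset.range N, x k ^ (2 * j) / ((2 : ℝ) ^ j * (j.factorial : ℝ))) =
        gaussFun (1 / 2) Q := by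
    funext x
    rw [gaussFun, mul_comm, hQdef]
    congr 1
    · simp only [Poly.toFun, map_sum, MvPolynomial.eval_monomial]
      refine Finset.sum_congr rfl fun j _ => ?_
      rw [Finsupp.prod_single_index (h := fun i e => x i ^ e) (pow_zero _), div_eq_inv_mul]
    · congr 1; ring
  rw [hfun]
  -- `D` contains all exponents in `S_Z`, and `S_Z` contains all monomials with exponent in `D₀`.
  let D : Set (Fin d →₀ ℕ) := {α | α k < 2 * N ∧ ∀ l, l ≠ k → α l ≤ 1}
  let D₀ : Set (Fin d →₀ ℕ) := {α | α k < 2 * N ∧ ∀ l, l ≠ k → α l = 0}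
  have hsingle : ∀ α : Fin d →₀ ℕ, (∀ l, l ≠ k → α l = 0) → α = Finsupp.single k (α k) := by
    intro α hα
    ext l
    by_cases hl : l = k
    · rw [hl, Finsupp.single_eq_same]
    · rw [hα l hl, Finsupp.single_eq_of_ne hl]
  have hD₀ : IsLowerSet D₀ := fun α β hβ hα =>
    ⟨(hβ k).trans_lt hα.1, fun l hl => Nat.le_zero.1 ((hβ l).trans_eq (hα.2 l hl))⟩
  have hD₀le : MvPolynomial.restrictSupport ℝ D₀ ≤ hermiteLeast z := by
    rw [MvPolynomial.restrictSupport_eq_span, Submodule.span_le]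
    rintro _ ⟨α, hα, rfl⟩
    dsimp only
    rw [hsingle α hα.2]
    exact monomial_single_mem_hermiteLeast hz hline hα.1
  have hcoeff : ∀ β ∈ D,
      MvPolynomial.coeff β Q = MvPowerSeries.coeff β (gaussSeries d (-(1 / 2))) := by
    rintro β ⟨hβk, hβ⟩
    rw [hQdef, MvPolynomial.coeff_sum, coeff_gaussSeries]
    simp only [MvPolynomial.coeff_monomial]
    by_cases hev : ∀ l, Even (β l)
    · have hoff : ∀ l, l ≠ k → β l = 0 := fun l hl => by
        obtain ⟨m, hm⟩ := hev l
        have := hβ l hl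
        omega
      obtain ⟨m, hm⟩ := hev k
      rw [← two_mul] at hm
      have hβe : Finsupp.single k (2 * m) = β := by rw [← hm]; exact (hsingle β hoff).symm
      rw [Finset.sum_eq_single_of_mem m (Finset.mem_range.2 (by omega)), if_pos hβe,
        ← Finset.mul_prod_erase _ _ (Finset.mem_univ k), Finset.prod_eq_one, mul_one, hm,
        gaussCoeff_two_mul, neg_neg, mul_inv, one_div, inv_pow, div_eq_mul_inv]
      · intro l hl
        rw [hoff l (Finset.ne_of_mem_erase hl), gaussCoeff_zero]
      · intro j _ hj
        rw [if_neg]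
        intro h
        have := DFunLike.congr_fun (h.trans hβe.symm) k
        rw [Finsupp.single_eq_same, Finsupp.single_eq_same] at this
        omega
    · push Not at hev
      obtain ⟨l, hl⟩ := hev
      rw [Finset.prod_eq_zero (Finset.mem_univ l) (gaussCoeff_odd _ (by simpa using hl))]
      refine Finset.sum_eq_zero fun j _ => if_neg ?_
      rintro rfl
      by_cases hlk : l = k
      · subst hlk
        simp at hl
      · rw [Finsupp.single_eq_of_ne hlk] at hl
        simp at hl
  have hQ : Q ∈ MvPolynomial.restrictSupport ℝ D₀ := by
    refine Submodule.sum_mem _ fun j hj =>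
      (MvPolynomial.monomial_mem_restrictSupport ℝ).2 (Or.inl ⟨?_, fun l hl => ?_⟩)
    · have := Finset.mem_range.1 hj
      rw [Finsupp.single_eq_same]
      omega
    · exact Finsupp.single_eq_of_ne hl
  obtain ⟨P₀, hP₀, hP₀Q⟩ := exists_hermiteMap_eq hD₀ hQ
  refine isEtaW_gaussFun (hD₀le ?_) (hD₀le hP₀) hP₀Q fun P hP => ?_
  · refine (MvPolynomial.monomial_mem_restrictSupport ℝ).2 (Or.inl ⟨?_, fun l _ => rfl⟩)
    change 0 < 2 * N
    omega
  · refine pairB_gaussFun_half_of_forall_le fun α hα β hβ => hcoeff β ?_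
    have := hermiteLeast_le_of_line hN hline hP hα
    exact ⟨(hβ k).trans_lt this.1, fun l hl => (hβ l).trans (this.2 l hl)⟩

end SpikeCert

end

theorem mainTheorem7 {d N : ℕ} (z : Fin N → Pt d) :
    (∀ (L : ℕ) (B : Finset (Poly d)) (R : Set (Poly d)),
      IsDeBoorBasis z B →
      (∀ P ∈ R, P.IsHomogeneous (L + 1)) →
      (B : Set (Poly d)) = monomialsUpTo d L ∪ R →
      IsEtaW (gaussianKernel d) z (fun x =>
        Real.exp (-‖x‖ ^ 2 / 2) *
          ∑ P ∈ B, pairB P (expHalfSq d) / pairB P P.toFun * P.toFun x)) ∧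
    (∀ (L : ℕ) (B : Finset (Poly d)),
      IsDeBoorBasis z B →
      (B : Set (Poly d)) = monomialsUpTo d L →
      IsEtaW (gaussianKernel d) z (fun x =>
        Real.exp (-‖x‖ ^ 2 / 2) *
          ∑ α ∈ (Fintype.piFinset fun _ : Fin d => Finset.range (L + 1)) with
              2 * ∑ i, α i ≤ L,
            (∏ i, x i ^ (2 * α i)) / ((2 : ℝ) ^ (∑ i, α i) * ∏ i, ((α i).factorial : ℝ)))) ∧
    (0 < N → Function.Injective z →
      ∀ k : Fin d, (∀ i j : Fin N, ∀ l : Fin d, l ≠ k → z i l = z j l) →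
      IsEtaW (gaussianKernel d) z (fun x =>
        Real.exp (-‖x‖ ^ 2 / 2) *
          ∑ j ∈ Finset.range N, x k ^ (2 * j) / ((2 : ℝ) ^ j * (j.factorial : ℝ)))) := by
  refine ⟨fun L B R hB hR hBR => isEtaW_of_homogeneous_top z L B R hB hR hBR,
    fun L B hB hBL => isEtaW_of_monomials z L B hB hBL,
    fun hN hz k hline => isEtaW_of_line hN hz hline⟩
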